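/- Let $\mathcal{H}$ be a real Hilbert space with a complex structure $I$, that is, a bounded real-linear operator with $I^2 = -1$ and $I^\dagger = -I$. Let $\mathcal{L} \subset \mathcal{H}$ be a closed real subspace that is standard, i.e. $\mathcal{L} \cap I\mathcal{L} = \{0\}$ and $\overline{\mathcal{L} + I\mathcal{L}} = \mathcal{H}$, and let $E$ be the orthogonal projector onto $\mathcal{L} = E\mathcal{H}$. Let $T$ be the Tomita operator of $\mathcal{L}$, the closure of the map $h + Ik \mapsto h - Ik$ ($h,k \in \mathcal{L}$), with polar decomposition $T = J\Delta^{1/2}$, so that $\Delta = T^\dagger T$ is the modular operator. Write $(I\ln\Delta)_V := E\,(I\ln\Delta)\,E$ for the operator with domain $\{h \in \mathcal{H} : Eh \in D(\ln\Delta)\}$. Then $$(I\ln\Delta)_V = -2\arctan(EIE),$$ as an equality of (in general unbounded) operators, including domains, where $\arctan$ of the skew-adjoint operator $EIE$ is defined by the Borel functional calculus on the complexification $\mathcal{H}_{\mathbb{C}} = \mathcal{H} \oplus \mathrm{i}\mathcal{H}$, to which the operators on both sides are extended complex-linearly. Moreover, if $\mathcal{G}$ is the bounded operator on $\mathcal{H}_{\mathbb{C}}$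 for which $I = -\mathrm{i}(1 - 2\mathcal{G})$ (for free Majorana fermions, with $\mathcal{H}$ the space of real initial data, $\mathcal{G}$ is the operator whose integral kernel is the Wightman two-point function), and $1_V := E$, $\mathcal{G}_V := E\mathcal{G}E$, then $$(I\ln\Delta)_V = -\mathrm{i} H_V, \qquad H_V := 2\mathrm{i}\arctan\bigl[\mathrm{i}(1_V - 2\mathcal{G}_V)\bigr].$$ -/

import Mathlib

open MeasureTheory Filter Topology

noncomputable section

/-! ### Complexification of a real Hilbert space -/

/-- The complexification `H ⊕ iH` of a real inner product space `H`. The pair `(a, b)` stands for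
`a + i b`. The norm is `‖a + i b‖² = ‖a‖² + ‖b‖²`. -/
def Complexification (H : Type*) : Type _ := WithLp 2 (H × H)

namespace Complexification

section Basic

variable {H : Type*}

/-- The vector `a + i b`. -/
def mk (a b : H) : Complexification H := WithLp.toLp 2 (a, b)

/-- The real part `a` of `a + i b`. -/
def re (x : Complexification H) : H := WithLp.fst x

/-- The imaginary part `b` of `a + i b`. -/
def im (x : Complexification H) : H := WithLp.snd x

@[simp] theorem re_mk (a b : H) : (mk a b).re = a := rfl
@[simp] theorem im_mk (a b : H) : (mk a b).im = b := rfl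

@[ext] theorem ext {x y : Complexification H} (h₁ : x.re = y.re) (h₂ : x.im = y.im) : x = y := by
  have : mk x.re x.im = mk y.re y.im := by rw [h₁, h₂]
  exact this

end Basic

section Norm

variable {H : Type*} [NormedAddCommGroup H]

instance : NormedAddCommGroup (Complexification H) :=
  inferInstanceAs (NormedAddCommGroup (WithLp 2 (H × H)))

instance [CompleteSpace H] : CompleteSpace (Complexification H) :=
  inferInstanceAs (CompleteSpace (WithLp 2 (H × H)))

@[simp] theorem re_add (x y : Complexification H) : (x + y).re = x.re + y.re := rfl
@[simp] theorem im_add (x y : Complexification H) : (x + y).im = x.im + y.im := rfl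

theorem norm_sq (x : Complexification H) : ‖x‖ ^ 2 = ‖x.re‖ ^ 2 + ‖x.im‖ ^ 2 :=
  WithLp.prod_norm_sq_eq_of_L2 (α := H) (β := H) x

end Norm

variable {H : Type*} [NormedAddCommGroup H] [InnerProductSpace ℝ H]

/-- `(s + i t)(a + i b) = (s a - t b) + i (s b + t a)`. -/
instance : SMul ℂ (Complexification H) where
  smul c x := mk (c.re • x.re - c.im • x.im) (c.re • x.im + c.im • x.re)

@[simp] theorem re_smul (c : ℂ) (x : Complexification H) :
    (c • x).re = c.re • x.re - c.im • x.im := rfl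
@[simp] theorem im_smul (c : ℂ) (x : Complexification H) :
    (c • x).im = c.re • x.im + c.im • x.re := rfl
@[simp] theorem re_zero : (0 : Complexification H).re = 0 := rfl
@[simp] theorem im_zero : (0 : Complexification H).im = 0 := rfl

instance : Module ℂ (Complexification H) where
  one_smul x := by ext <;> simp
  mul_smul c d x := by ext <;> simp <;> module
  smul_zero c := by ext <;> simp
  smul_add c x y := by ext <;> simp <;> module
  add_smul c d x := by ext <;> simp <;> module
  zero_smul x := by ext <;> simp

/-- The sesquilinear extension of the real inner product (conjugate-linear in the first slot). -/
instance : InnerProductSpace ℂ (Complexification H) where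
  inner x y := ⟨inner ℝ x.re y.re + inner ℝ x.im y.im, inner ℝ x.re y.im - inner ℝ x.im y.re⟩
  norm_smul_le c x := by
    refine le_of_sq_le_sq ?_ (by positivity)
    rw [mul_pow, norm_sq, norm_sq, Complex.sq_norm, Complex.normSq_apply, re_smul, im_smul,
      norm_sub_sq_real, norm_add_sq_real]
    simp only [norm_smul, inner_smul_left, inner_smul_right, mul_pow, Real.norm_eq_abs, sq_abs,
      real_inner_comm x.re x.im, conj_trivial]
    apply le_of_eq
    ring
  norm_sq_eq_re_inner x := by
    rw [norm_sq]
    simp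
  conj_inner_symm x y := by
    apply Complex.ext <;> simp [real_inner_comm]
  add_left x y z := by
    apply Complex.ext <;> simp [inner_add_left] <;> ring
  smul_left x y c := by
    apply Complex.ext <;> simp [inner_add_left, inner_sub_left, inner_smul_left] <;> ring

/-- The complex-linear extension `a + i b ↦ A a + i A b` of a bounded operator `A` on `H`. -/
def mapCLM (A : H →L[ℝ] H) : Complexification H →L[ℂ] Complexification H :=
  LinearMap.mkContinuous
    { toFun := fun x => mk (A x.re) (A x.im)
      map_add' := fun x y => by ext <;> simp
      map_smul' := fun c x => by ext <;> simp }
    ‖A‖ (fun x => by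
      refine le_of_sq_le_sq ?_ (by positivity)
      have h₁ : ‖A x.re‖ ^ 2 ≤ (‖A‖ * ‖x.re‖) ^ 2 := by gcongr; exact A.le_opNorm _
      have h₂ : ‖A x.im‖ ^ 2 ≤ (‖A‖ * ‖x.im‖) ^ 2 := by gcongr; exact A.le_opNorm _
      have h₃ := norm_sq (mk (A x.re) (A x.im))
      have h₄ := norm_sq x
      simp only [re_mk, im_mk] at h₃
      simp only [LinearMap.coe_mk, AddHom.coe_mk]
      rw [h₃, mul_pow, h₄]
      nlinarith)

end Complexification

/-! ### (Unbounded) operators, given by their graphs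

An operator with domain is identified with its graph, a set of pairs `(x, A x)`; two operators are
equal (domains included) iff their graphs are. -/

/-- The graph of an everywhere defined bounded operator. -/
def graphOfCLM {𝕜 K : Type*} [RCLike 𝕜] [NormedAddCommGroup K] [InnerProductSpace 𝕜 K]
    (A : K →L[𝕜] K) : Set (K × K) :=
  {p | p.2 = A p.1}

/-- The graph of `c A`, with the same domain as `A`. -/
def smulGraph {𝕜 K : Type*} [RCLike 𝕜] [NormedAddCommGroup K] [InnerProductSpace 𝕜 K]
    (c : 𝕜) (A : Set (K × K)) : Set (K × K) :=
  {p | ∃ y, (p.1, y) ∈ A ∧ p.2 = c • y}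

/-- The graph of the complex-linear extension `a + i b ↦ A a + i A b` of an operator `A` on `H`;
its domain is `D(A) + i D(A)`. -/
def complexifyGraph {H : Type*} [NormedAddCommGroup H] [InnerProductSpace ℝ H]
    (A : Set (H × H)) : Set (Complexification H × Complexification H) :=
  {p | (p.1.re, p.2.re) ∈ A ∧ (p.1.im, p.2.im) ∈ A}

/-! ### Projection-valued measures and the Borel functional calculus -/

/-- A projection-valued measure on `α` with values in the orthogonal projections of the Hilbert
space `K` (its values on non-measurable sets play no role). -/
structure ProjectionValuedMeasure (𝕜 K α : Type*) [RCLike 𝕜] [NormedAddCommGroup K]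
    [InnerProductSpace 𝕜 K] [CompleteSpace K] [MeasurableSpace α] where
  /-- The projection of a set. -/
  proj : Set α → K →L[𝕜] K
  isStarProjection : ∀ s, MeasurableSet s → IsStarProjection (proj s)
  proj_univ : proj Set.univ = 1
  proj_inter : ∀ s t, MeasurableSet s → MeasurableSet t → proj (s ∩ t) = proj s * proj t
  hasSum_iUnion : ∀ s : ℕ → Set α, (∀ n, MeasurableSet (s n)) → Pairwise (Function.onFun Disjoint s) →
    ∀ x, HasSum (fun n => proj (s n) x) (proj (⋃ n, s n) x)

namespace ProjectionValuedMeasure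

variable {𝕜 K α : Type*} [RCLike 𝕜] [NormedAddCommGroup K] [InnerProductSpace 𝕜 K]
  [CompleteSpace K] [MeasurableSpace α]

theorem proj_empty (P : ProjectionValuedMeasure 𝕜 K α) : P.proj ∅ = 0 := by
  ext x
  have h := P.hasSum_iUnion (fun _ => ∅) (fun _ => MeasurableSet.empty)
    (fun i j _ => by simp [Function.onFun]) x
  have h' := h.summable.tendsto_atTop_zero
  simpa using tendsto_nhds_unique tendsto_const_nhds h'

theorem re_inner_nonneg (P : ProjectionValuedMeasure 𝕜 K α) {s : Set α} (hs : MeasurableSet s)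
    (x : K) : 0 ≤ RCLike.re (inner 𝕜 x (P.proj s x)) := by
  have h := P.isStarProjection s hs
  have h₁ : P.proj s x = P.proj s (P.proj s x) := by
    conv_lhs => rw [← h.isIdempotentElem.eq]
    rfl
  have h₂ : inner 𝕜 x (P.proj s (P.proj s x)) = inner 𝕜 (P.proj s x) (P.proj s x) := by
    rw [← ContinuousLinearMap.adjoint_inner_left]
    rw [← ContinuousLinearMap.star_eq_adjoint, h.isSelfAdjoint.star_eq]
  rw [h₁, h₂]
  exact inner_self_nonneg

/-- The finite measure `s ↦ ⟪x, P(s) x⟫`. -/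
def measure (P : ProjectionValuedMeasure 𝕜 K α) (x : K) : Measure α :=
  Measure.ofMeasurable (fun s _ => ENNReal.ofReal (RCLike.re (inner 𝕜 x (P.proj s x))))
    (by simp [proj_empty])
    (fun s hs hd => by
      have h := P.hasSum_iUnion s hs hd x
      have h₁ : HasSum (fun n => RCLike.re (inner 𝕜 x (P.proj (s n) x)))
          (RCLike.re (inner 𝕜 x (P.proj (⋃ n, s n) x))) :=
        (h.mapL (innerSL 𝕜 x)).mapL (RCLike.reCLM (K := 𝕜))
      rw [← h₁.tsum_eq]
      exact ENNReal.ofReal_tsum_of_nonneg (fun n => P.re_inner_nonneg (hs n) x) h₁.summable)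

/-- The vector `∑ c P(s = c) x`, the integral of the simple function `s` applied to `x`. -/
def simpleIntegral (P : ProjectionValuedMeasure 𝕜 K α) (s : SimpleFunc α 𝕜) (x : K) : K :=
  ∑ c ∈ s.range, c • P.proj (s ⁻¹' {c}) x

/-- The graph of the (in general unbounded) operator `∫ f dP`. Its domain consists of the `x` with
`f ∈ L²(⟪x, P(·) x⟫)`, and it maps such an `x` to the limit of `(∫ sₙ dP) x` for simple functions
`sₙ → f` in `L²(⟪x, P(·) x⟫)`. -/
def integral (P : ProjectionValuedMeasure 𝕜 K α) (f : α → 𝕜) : Set (K × K) :=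
  {p | ∃ s : ℕ → SimpleFunc α 𝕜,
    Tendsto (fun n => ∫⁻ z, ‖f z - s n z‖ₑ ^ 2 ∂(P.measure p.1)) atTop (𝓝 0) ∧
    Tendsto (fun n => P.simpleIntegral (s n) p.1) atTop (𝓝 p.2)}

end ProjectionValuedMeasure

/-- `P` is the spectral measure of the operator with graph `A`: `A = ∫ z dP(z)`, domains included.
For `𝕜 = ℝ` this is the spectral measure of a selfadjoint operator, for `𝕜 = ℂ` that of a normal
operator. -/
def IsSpectralMeasure {𝕜 K : Type*} [RCLike 𝕜] [NormedAddCommGroup K] [InnerProductSpace 𝕜 K]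
    [CompleteSpace K] [MeasurableSpace 𝕜] [BorelSpace 𝕜] (P : ProjectionValuedMeasure 𝕜 K 𝕜)
    (A : Set (K × K)) : Prop :=
  P.integral (fun z => z) = A

/-- The Borel functional calculus: the graph of `f(A) = ∫ f dP`, where `P` is the spectral measure
of the operator with graph `A`. -/
def borelCalculus {𝕜 K : Type*} [RCLike 𝕜] [NormedAddCommGroup K] [InnerProductSpace 𝕜 K]
    [CompleteSpace K] [MeasurableSpace 𝕜] [BorelSpace 𝕜] (f : 𝕜 → 𝕜) (A : Set (K × K)) : Set (K × K) :=
  {p | ∃ P : ProjectionValuedMeasure 𝕜 K 𝕜, IsSpectralMeasure P A ∧ p ∈ P.integral f}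

/-! ### Standard subspaces and their modular theory -/

section Modular

variable {H : Type*} [NormedAddCommGroup H] [InnerProductSpace ℝ H] [CompleteSpace H]

/-- A complex structure: `I² = -1` and `I† = -I`. -/
structure IsComplexStructure (I : H →L[ℝ] H) : Prop where
  sq_eq : I ∘L I = -ContinuousLinearMap.id ℝ H
  adjoint_eq : ContinuousLinearMap.adjoint I = -I

/-- A closed real subspace `L` is standard if it is separating, `L ∩ I L = 0`, and cyclic,
`L + I L` is dense. -/
structure IsStandard (I : H →L[ℝ] H) (L : ClosedSubmodule ℝ H) : Prop where
  separating : L.toSubmodule ⊓ L.toSubmodule.map I.toLinearMap = ⊥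
  cyclic : (L.toSubmodule ⊔ L.toSubmodule.map I.toLinearMap).topologicalClosure = ⊤

/-- The graph `{(h + I k, h - I k) | h, k ∈ L}`. -/
def preTomitaGraph (I : H →L[ℝ] H) (L : ClosedSubmodule ℝ H) : Submodule ℝ (H × H) where
  carrier := {p | ∃ h ∈ L, ∃ k ∈ L, p = (h + I k, h - I k)}
  zero_mem' := ⟨0, zero_mem L, 0, zero_mem L, by simp; rfl⟩
  add_mem' := by
    rintro _ _ ⟨h, hh, k, hk, rfl⟩ ⟨h', hh', k', hk', rfl⟩
    refine ⟨h + h', add_mem hh hh', k + k', add_mem hk hk', ?_⟩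
    ext <;> simp <;> abel
  smul_mem' := by
    rintro c _ ⟨h, hh, k, hk, rfl⟩
    refine ⟨c • h, L.toSubmodule.smul_mem c hh, c • k, L.toSubmodule.smul_mem c hk, ?_⟩
    ext <;> simp [smul_sub]

/-- The Tomita operator `T` of `L`: the closure of the map `h + I k ↦ h - I k`, `h, k ∈ L`. -/
def tomitaOperator (I : H →L[ℝ] H) (L : ClosedSubmodule ℝ H) : H →ₗ.[ℝ] H :=
  (preTomitaGraph I L).toLinearPMap.closure

/-- The graph of the modular operator `Δ = T† T`, that is, of the square of the positive part of
the polar decomposition `T = J Δ^(1/2)`. The adjoint is taken for the real inner product; for an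
antilinear `T` it is the usual antilinear adjoint. -/
def modularOperator (I : H →L[ℝ] H) (L : ClosedSubmodule ℝ H) : Set (H × H) :=
  {p | ∃ y, (p.1, y) ∈ (tomitaOperator I L).graph ∧ (y, p.2) ∈ (tomitaOperator I L).adjoint.graph}

/-- The graph of `ln Δ`. -/
def logModularOperator (I : H →L[ℝ] H) (L : ClosedSubmodule ℝ H) : Set (H × H) :=
  borelCalculus Real.log (modularOperator I L)

/-- The graph of `(I ln Δ)_V = E (I ln Δ) E`, where `E` is the orthogonal projector onto `L`; its
domain is `{x | E x ∈ D(ln Δ)}`. -/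
def restrictedModularGenerator (I : H →L[ℝ] H) (L : ClosedSubmodule ℝ H) : Set (H × H) :=
  {p | ∃ y, (L.toSubmodule.starProjection p.1, y) ∈ logModularOperator I L ∧
    p.2 = L.toSubmodule.starProjection (I y)}

/-- The graph of `H_V = 2 i arctan[i (1_V - 2 G_V)]` with `G_V = E G E` and `1_V = E`. -/
def modularHamiltonian (E G : Complexification H →L[ℂ] Complexification H) :
    Set (Complexification H × Complexification H) :=
  smulGraph (2 * Complex.I)
    (borelCalculus Complex.arctan (graphOfCLM (Complex.I • (E - (2 : ℂ) • (E ∘L G ∘L E)))))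

end Modular

end

/-!
The proof follows the bounded-operator approach to modular theory of Rieffel and van Daele, and
avoids any uniqueness theorem for spectral measures by describing both sides through power series.

Let `E' = -I E I` be the projector onto `I L`, and `S = (E + E') / 2`. Writing out the graphs of
the Tomita operator `T` and of `T†` gives `Δ = (1 - S) S⁻¹` (`mem_modularOperator_iff`). The Cayley
transform `D = (1 - Δ) / (1 + Δ) = E + E' - 1` satisfies `(I D) E = E I E = E (I D)`, and `I`
commutes with `D`, so that `(E I E)^(2k+1) = (-1)^k I D^(2k+1) E` (`compression_pow`).

The partial sums of the series of `artanh` have terms of one sign on `(-1, 1)`, hence are dominated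
by their sum. By dominated convergence and Fatou's lemma (`mem_integral_iff_tendsto`), for *every*
projection-valued measure `P` representing the operator, the spectral integral is the strong limit
of the partial sums, with the set of convergence as its domain. This applies to
`ln Δ = -2 artanh D` (`mem_logModularOperator_iff`) and, on the imaginary axis, to `arctan A` for a
skew-adjoint `A` with `‖A x‖ < ‖x‖` for `x ≠ 0` (`mem_borelCalculus_arctan_iff`). The compression
`E I E` is such an `A`, because `L ∩ I L = 0`. Comparing the partial sums term by term yields the
equality of operators, domains included. For the second equality, `i (1_V - 2 G_V) = -E I E` and
the partial sums of `arctan` are odd.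

Spectral measures still have to exist. On a complex Hilbert space, the continuous functional
calculus and the Riesz–Markov–Kakutani theorem give scalar measures `μ x` with
`∫ p dμ x = ⟪x, p(M) x⟫` for a bounded selfadjoint `M`; on a real one they are obtained by
complexification. The projection of a Borel set `s` maps `x` to the limit of `pₙ(M) x` for
polynomials `pₙ → 1_s` in `L²(μ x)` (`IsScalarSpectralFamily.pvm`). The spectral measures of `Δ`
and of `E I E` are push-forwards of those of `S` and of `-i E I E`.
-/

noncomputable section

/-! ### Preliminaries on `L²` and simple functions -/

theorem ENNReal.tendsto_zero_of_sq {ι : Type*} {l : Filter ι} {u : ι → ENNReal}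
    (h : Tendsto (fun i => u i ^ 2) l (𝓝 0)) : Tendsto u l (𝓝 0) := by
  have h₁ := ((ENNReal.continuous_rpow_const (y := 1 / 2)).tendsto 0).comp h
  rw [ENNReal.zero_rpow_of_pos (by norm_num)] at h₁
  refine h₁.congr fun i => ?_
  simp only [Function.comp]
  rw [← ENNReal.rpow_natCast, ← ENNReal.rpow_mul]
  norm_num

namespace MeasureTheory

variable {α F : Type*} [MeasurableSpace α]

theorem eLpNorm_two_sq [NormedAddCommGroup F] (μ : Measure α)
    (f : α → F) : eLpNorm f 2 μ ^ 2 = ∫⁻ z, ‖f z‖ₑ ^ 2 ∂μ := by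
  have h := eLpNorm_nnreal_pow_eq_lintegral (f := f) (μ := μ) (p := 2) (by norm_num)
  norm_num at h
  exact h

theorem tendsto_eLpNorm_two_iff [NormedAddCommGroup F] (μ : Measure α) (f : ℕ → α → F) :
    Tendsto (fun n => ∫⁻ z, ‖f n z‖ₑ ^ 2 ∂μ) atTop (𝓝 0) ↔
      Tendsto (fun n => eLpNorm (f n) 2 μ) atTop (𝓝 0) := by
  simp only [← eLpNorm_two_sq]
  constructor
  · exact ENNReal.tendsto_zero_of_sq
  · intro h
    have := ((ENNReal.continuous_pow 2).tendsto 0).comp h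
    rwa [zero_pow two_ne_zero] at this

namespace SimpleFunc

/-- A simple function as a function, additively. -/
def coeAddHom (α F : Type*) [MeasurableSpace α] [AddCommGroup F] : SimpleFunc α F →+ α → F :=
  AddMonoidHom.mk' (fun s => s) fun _ _ => rfl

theorem exists_tendsto_eLpNorm_two_sub {𝕜 : Type*} [RCLike 𝕜] {μ : Measure α} {f : α → 𝕜}
    (hf : Measurable f) (hf2 : MemLp f 2 μ) : ∃ s : ℕ → SimpleFunc α 𝕜,
      Tendsto (fun n => eLpNorm (f - (s n : α → 𝕜)) 2 μ) atTop (𝓝 0) := by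
  borelize 𝕜
  refine ⟨fun n => approxOn f hf (Set.range f ∪ {0}) 0 (by simp) n,
    (tendsto_approxOn_range_Lp_eLpNorm (p := 2) (by norm_num) hf hf2.2).congr fun n => ?_⟩
  rw [← eLpNorm_neg]
  congr 1
  exact neg_sub _ _

theorem sum_smul_indicator_fiber {R : Type*} [Semiring R] (s : SimpleFunc α R) (f : α → R) :
    ∑ c ∈ s.range, c • (s ⁻¹' {c}).indicator f = s * f := by
  ext z
  rw [Finset.sum_apply, Finset.sum_eq_single (s z)]
  · simp
  · intro c _ hc
    simp [hc.symm]
  · exact fun h => absurd (s.mem_range_self z) h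

end SimpleFunc

end MeasureTheory

/-! ### Extending an isometric map along `L²` convergence -/

/-- `y` is the value at `f` of the continuous extension to `L²(μ)` of the assignment `φ i ↦ D i`:
there are indices `u n` with `φ (u n) → f` in `L²(μ)` and `D (u n) → y`. -/
def IsL2Limit {α ι F E : Type*} [MeasurableSpace α] [NormedAddCommGroup F] [NormedAddCommGroup E]
    (μ : Measure α) (φ : ι → α → F) (D : ι → E) (f : α → F) (y : E) : Prop :=
  ∃ u : ℕ → ι, Tendsto (fun n => eLpNorm (f - φ (u n)) 2 μ) atTop (𝓝 0) ∧
    Tendsto (fun n => D (u n)) atTop (𝓝 y)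

namespace IsL2Limit

variable {α ι F E : Type*} [MeasurableSpace α] [NormedAddCommGroup F] [NormedAddCommGroup E]
  {μ : Measure α}

theorem self {φ : ι → α → F} {D : ι → E} (i : ι) : IsL2Limit μ φ D (φ i) (D i) :=
  ⟨fun _ => i, by simp, tendsto_const_nhds⟩

theorem congr_ae {φ : ι → α → F} {D : ι → E} {f g : α → F} {y : E} (h : IsL2Limit μ φ D f y)
    (hfg : f =ᵐ[μ] g) : IsL2Limit μ φ D g y := by
  obtain ⟨u, h₁, h₂⟩ := h
  refine ⟨u, h₁.congr fun n => eLpNorm_congr_ae ?_, h₂⟩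
  filter_upwards [hfg] with z hz
  simp [hz]

/-- The graph of the `L²` extension is closed. -/
theorem closed {φ : ι → α → F} {D : ι → E} (hm : ∀ i, AEStronglyMeasurable (φ i) μ)
    {f : α → F} (hf : AEStronglyMeasurable f μ) {fs : ℕ → α → F}
    (hfs : ∀ n, AEStronglyMeasurable (fs n) μ) {ys : ℕ → E} {y : E}
    (h : ∀ n, IsL2Limit μ φ D (fs n) (ys n))
    (hlim : Tendsto (fun n => eLpNorm (f - fs n) 2 μ) atTop (𝓝 0))
    (hy : Tendsto ys atTop (𝓝 y)) : IsL2Limit μ φ D f y := by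
  have key : ∀ n : ℕ, ∃ i, eLpNorm (fs n - φ i) 2 μ < ((n : ENNReal) + 1)⁻¹ ∧
      edist (D i) (ys n) < ((n : ENNReal) + 1)⁻¹ := fun n => by
    obtain ⟨u, h₁, h₂⟩ := h n
    have hpos : (0 : ENNReal) < ((n : ENNReal) + 1)⁻¹ := by simp
    obtain ⟨k, hk₁, hk₂⟩ :=
      ((h₁.eventually_lt_const hpos).and (EMetric.tendsto_nhds.1 h₂ _ hpos)).exists
    exact ⟨u k, hk₁, hk₂⟩
  choose i hi₁ hi₂ using key
  have h0 : Tendsto (fun n : ℕ => ((n : ENNReal) + 1)⁻¹) atTop (𝓝 0) := by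
    have := (tendsto_add_atTop_iff_nat 1).2 ENNReal.tendsto_inv_nat_nhds_zero
    simpa using this
  refine ⟨i, ?_, ?_⟩
  · have hs : Tendsto (fun n => eLpNorm (f - fs n) 2 μ + ((n : ENNReal) + 1)⁻¹) atTop (𝓝 0) := by
      simpa using hlim.add h0
    refine tendsto_of_tendsto_of_tendsto_of_le_of_le tendsto_const_nhds hs (fun _ => zero_le)
      fun n => ?_
    have : f - φ (i n) = (f - fs n) + (fs n - φ (i n)) := by abel
    change eLpNorm (f - φ (i n)) 2 μ ≤ _
    rw [this]
    exact (eLpNorm_add_le (hf.sub (hfs n)) ((hfs n).sub (hm _)) (by norm_num)).trans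
      (add_le_add_right (hi₁ n).le _)
  · rw [tendsto_iff_edist_tendsto_0] at hy ⊢
    have hs : Tendsto (fun n : ℕ => ((n : ENNReal) + 1)⁻¹ + edist (ys n) y) atTop (𝓝 0) := by
      simpa using h0.add hy
    refine tendsto_of_tendsto_of_tendsto_of_le_of_le tendsto_const_nhds hs (fun _ => zero_le)
      fun n => ?_
    exact (edist_triangle _ (ys n) _).trans (add_le_add_left (hi₂ n).le _)

variable [AddCommGroup ι] {φ : ι →+ α → F} {D : ι →+ E} {f g : α → F} {y z : E}

theorem add (hm : ∀ i, AEStronglyMeasurable (φ i) μ)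
    (hf : AEStronglyMeasurable f μ) (hg : AEStronglyMeasurable g μ)
    (hy : IsL2Limit μ φ D f y) (hz : IsL2Limit μ φ D g z) : IsL2Limit μ φ D (f + g) (y + z) := by
  obtain ⟨u, hu, hu'⟩ := hy
  obtain ⟨v, hv, hv'⟩ := hz
  refine ⟨fun n => u n + v n, ?_, ?_⟩
  · have hs := hu.add hv
    rw [add_zero] at hs
    refine tendsto_of_tendsto_of_tendsto_of_le_of_le tendsto_const_nhds hs (fun _ => zero_le)
      fun n => ?_
    have : f + g - φ (u n + v n) = (f - φ (u n)) + (g - φ (v n)) := by rw [map_add]; abel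
    change eLpNorm (f + g - φ (u n + v n)) 2 μ ≤ _
    rw [this]
    exact eLpNorm_add_le (hf.sub (hm _)) (hg.sub (hm _)) (by norm_num)
  · simpa using hu'.add hv'

theorem neg (hy : IsL2Limit μ φ D f y) : IsL2Limit μ φ D (-f) (-y) := by
  obtain ⟨u, hu, hu'⟩ := hy
  refine ⟨fun n => -u n, ?_, by simpa using hu'.neg⟩
  refine hu.congr fun n => ?_
  rw [← eLpNorm_neg]
  congr 1
  rw [map_neg]
  abel

theorem sub (hm : ∀ i, AEStronglyMeasurable (φ i) μ)
    (hf : AEStronglyMeasurable f μ) (hg : AEStronglyMeasurable g μ)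
    (hy : IsL2Limit μ φ D f y) (hz : IsL2Limit μ φ D g z) : IsL2Limit μ φ D (f - g) (y - z) := by
  rw [sub_eq_add_neg, sub_eq_add_neg]
  exact add hm hf hg.neg hy hz.neg

theorem enorm_eq (hm : ∀ i, AEStronglyMeasurable (φ i) μ) (hD : ∀ i, ‖D i‖ₑ = eLpNorm (φ i) 2 μ)
    (hf : AEStronglyMeasurable f μ) (hy : IsL2Limit μ φ D f y) : ‖y‖ₑ = eLpNorm f 2 μ := by
  obtain ⟨u, hu, hu'⟩ := hy
  have hn : Tendsto (fun n => eLpNorm (φ (u n)) 2 μ) atTop (𝓝 ‖y‖ₑ) := by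
    simpa only [← hD] using hu'.enorm
  apply le_antisymm
  · have hs := (tendsto_const_nhds (x := eLpNorm f 2 μ)).add hu
    rw [add_zero] at hs
    refine le_of_tendsto_of_tendsto' hn hs fun n => ?_
    have : φ (u n) = f - (f - φ (u n)) := by abel
    conv_lhs => rw [this]
    exact eLpNorm_sub_le hf (hf.sub (hm _)) (by norm_num)
  · have hs := hu.add hn
    rw [zero_add] at hs
    refine ge_of_tendsto' hs fun n => ?_
    have : f = (f - φ (u n)) + φ (u n) := by abel
    conv_lhs => rw [this]
    exact eLpNorm_add_le (hf.sub (hm _)) (hm _) (by norm_num)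

theorem edist_eq (hm : ∀ i, AEStronglyMeasurable (φ i) μ) (hD : ∀ i, ‖D i‖ₑ = eLpNorm (φ i) 2 μ)
    (hf : AEStronglyMeasurable f μ) (hg : AEStronglyMeasurable g μ)
    (hy : IsL2Limit μ φ D f y) (hz : IsL2Limit μ φ D g z) : edist y z = eLpNorm (f - g) 2 μ := by
  rw [edist_eq_enorm_sub, enorm_eq hm hD (hf.sub hg) (sub hm hf hg hy hz)]

theorem unique (hm : ∀ i, AEStronglyMeasurable (φ i) μ) (hD : ∀ i, ‖D i‖ₑ = eLpNorm (φ i) 2 μ)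
    (hf : AEStronglyMeasurable f μ) (hy : IsL2Limit μ φ D f y) (hz : IsL2Limit μ φ D f z) :
    y = z := by
  rw [← edist_eq_zero, edist_eq hm hD hf hf hy hz]
  simp

theorem tendsto (hm : ∀ i, AEStronglyMeasurable (φ i) μ) (hD : ∀ i, ‖D i‖ₑ = eLpNorm (φ i) 2 μ)
    (hf : AEStronglyMeasurable f μ) {fs : ℕ → α → F}
    (hfs : ∀ n, AEStronglyMeasurable (fs n) μ) {ys : ℕ → E}
    (h : ∀ n, IsL2Limit μ φ D (fs n) (ys n)) (hy : IsL2Limit μ φ D f y)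
    (hlim : Tendsto (fun n => eLpNorm (f - fs n) 2 μ) atTop (𝓝 0)) :
    Tendsto ys atTop (𝓝 y) := by
  rw [tendsto_iff_edist_tendsto_0]
  refine hlim.congr fun n => ?_
  rw [edist_comm, edist_eq hm hD hf (hfs n) hy (h n)]

theorem exists_of_tendsto [CompleteSpace E] (hm : ∀ i, AEStronglyMeasurable (φ i) μ)
    (hD : ∀ i, ‖D i‖ₑ = eLpNorm (φ i) 2 μ) (hf : AEStronglyMeasurable f μ) {u : ℕ → ι}
    (hu : Tendsto (fun n => eLpNorm (f - φ (u n)) 2 μ) atTop (𝓝 0)) :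
    ∃ y, IsL2Limit μ φ D f y := by
  have hc : CauchySeq (fun n => D (u n)) := by
    rw [EMetric.cauchySeq_iff]
    intro ε hε
    have hε2 : 0 < ε / 2 := ENNReal.half_pos hε.ne'
    obtain ⟨N, hN⟩ := eventually_atTop.1 (hu.eventually_lt_const hε2)
    refine ⟨N, fun m hmN n hnN => ?_⟩
    rw [edist_eq_enorm_sub, ← map_sub, hD, map_sub]
    have : φ (u m) - φ (u n) = (f - φ (u n)) - (f - φ (u m)) := by abel
    rw [this]
    calc _ ≤ _ := eLpNorm_sub_le (hf.sub (hm _)) (hf.sub (hm _)) (by norm_num)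
      _ < ε / 2 + ε / 2 := ENNReal.add_lt_add (hN n hnN) (hN m hmN)
      _ = ε := ENNReal.add_halves ε
  obtain ⟨y, hy⟩ := cauchySeq_tendsto_of_complete hc
  exact ⟨y, u, hu, hy⟩

end IsL2Limit

namespace ProjectionValuedMeasure

/-! ### Projection-valued measures: elementary properties -/

variable {𝕜 K α β : Type*} [RCLike 𝕜] [NormedAddCommGroup K] [InnerProductSpace 𝕜 K]
  [CompleteSpace K] [MeasurableSpace α] [MeasurableSpace β] (P : ProjectionValuedMeasure 𝕜 K α)

theorem proj_proj {s t : Set α} (hs : MeasurableSet s) (ht : MeasurableSet t) (x : K) :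
    P.proj s (P.proj t x) = P.proj (s ∩ t) x := by
  rw [P.proj_inter s t hs ht]
  rfl

theorem inner_proj_left {s : Set α} (hs : MeasurableSet s) (x y : K) :
    inner 𝕜 (P.proj s x) y = inner 𝕜 x (P.proj s y) := by
  rw [← ContinuousLinearMap.adjoint_inner_right, ← ContinuousLinearMap.star_eq_adjoint,
    (P.isStarProjection s hs).isSelfAdjoint.star_eq]

theorem measure_apply {s : Set α} (hs : MeasurableSet s) (x : K) :
    P.measure x s = ‖P.proj s x‖ₑ ^ 2 := by
  have h : inner 𝕜 x (P.proj s x) = inner 𝕜 (P.proj s x) (P.proj s x) := by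
    rw [P.inner_proj_left hs, P.proj_proj hs hs, Set.inter_self]
  rw [measure, Measure.ofMeasurable_apply _ hs, h, inner_self_eq_norm_sq,
    ENNReal.ofReal_pow (norm_nonneg _), ofReal_norm]

instance (x : K) : IsFiniteMeasure (P.measure x) :=
  ⟨by
    rw [P.measure_apply MeasurableSet.univ]
    exact ENNReal.pow_lt_top enorm_lt_top⟩

/-- The vector-valued measure `s ↦ P(s) x`. -/
def vectorMeasure (x : K) : VectorMeasure α K := by
  classical
  exact
  { measureOf' := fun s => if MeasurableSet s then P.proj s x else 0
    empty' := by simp [P.proj_empty]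
    not_measurable' := fun s hs => by simp [hs]
    m_iUnion' := fun s hs hd => by
      simpa [hs, MeasurableSet.iUnion hs] using P.hasSum_iUnion s hs hd x }

theorem vectorMeasure_apply {s : Set α} (hs : MeasurableSet s) (x : K) :
    P.vectorMeasure x s = P.proj s x := by
  classical
  change (if MeasurableSet s then P.proj s x else 0) = _
  rw [if_pos hs]

/-! ### The integral of simple functions -/

/-- The integral of a simple function can be computed on any finer partition. -/
theorem simpleIntegral_map {γ : Type*} (t : SimpleFunc α γ) (g : γ → 𝕜) (x : K) :
    P.simpleIntegral (t.map g) x = ∑ c ∈ t.range, g c • P.proj (t ⁻¹' {c}) x := by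
  classical
  have h : ∀ d, P.proj ((t.map g) ⁻¹' {d}) x =
      ∑ c ∈ t.range with g c = d, P.proj (t ⁻¹' {c}) x := fun d => by
    have hU : (t.map g) ⁻¹' {d} = ⋃ c ∈ t.range.filter (fun c => g c = d), t ⁻¹' {c} := by
      ext z
      simp
    rw [hU, ← P.vectorMeasure_apply (Finset.measurableSet_biUnion _
      fun c _ => t.measurableSet_fiber c)]
    rw [VectorMeasure.of_biUnion_finset]
    · exact Finset.sum_congr rfl fun c _ => P.vectorMeasure_apply (t.measurableSet_fiber c) x
    · intro a _ b _ hab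
      exact Set.disjoint_left.2 fun z hz hz' => hab (by simp_all)
    · exact fun c _ => t.measurableSet_fiber c
  rw [simpleIntegral, SimpleFunc.range_map]
  rw [← Finset.sum_fiberwise_of_maps_to (g := g) (t := t.range.image g)
    (fun c hc => Finset.mem_image_of_mem g hc)]
  refine Finset.sum_congr rfl fun d _ => ?_
  rw [h, Finset.smul_sum]
  refine Finset.sum_congr rfl fun c hc => ?_
  rw [(Finset.mem_filter.1 hc).2]

theorem simpleIntegral_add (s t : SimpleFunc α 𝕜) (x : K) :
    P.simpleIntegral (s + t) x = P.simpleIntegral s x + P.simpleIntegral t x := by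
  have h₁ : s = (s.pair t).map Prod.fst := by ext; rfl
  have h₂ : t = (s.pair t).map Prod.snd := by ext; rfl
  have h₃ : s + t = (s.pair t).map (fun p => p.1 + p.2) := by ext; rfl
  have e₁ := P.simpleIntegral_map (s.pair t) Prod.fst x
  have e₂ := P.simpleIntegral_map (s.pair t) Prod.snd x
  rw [← h₁] at e₁
  rw [← h₂] at e₂
  rw [h₃, simpleIntegral_map, e₁, e₂, ← Finset.sum_add_distrib]
  exact Finset.sum_congr rfl fun c _ => add_smul _ _ _

theorem simpleIntegral_smul (c : 𝕜) (s : SimpleFunc α 𝕜) (x : K) :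
    P.simpleIntegral (c • s) x = c • P.simpleIntegral s x := by
  have h : c • s = s.map (fun z => c • z) := by ext; rfl
  rw [h, simpleIntegral_map, simpleIntegral, Finset.smul_sum]
  exact Finset.sum_congr rfl fun d _ => by rw [smul_smul, smul_eq_mul]

/-- The integral of simple functions, applied to a fixed vector, as an additive map. -/
def simpleIntegralHom (x : K) : SimpleFunc α 𝕜 →+ K :=
  AddMonoidHom.mk' (fun s => P.simpleIntegral s x) fun s t => P.simpleIntegral_add s t x

theorem proj_simpleIntegral {s : Set α} (hs : MeasurableSet s) (t : SimpleFunc α 𝕜) (x : K) :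
    P.proj s (P.simpleIntegral t x) = P.simpleIntegral (t.restrict s) x := by
  classical
  set r := t.pair (SimpleFunc.piecewise s hs (SimpleFunc.const α True) (SimpleFunc.const α False))
    with hr
  have h₁ : t = r.map Prod.fst := by ext; rfl
  have h₂ : t.restrict s = r.map (fun p => if p.2 then p.1 else 0) := by
    ext z
    by_cases hz : z ∈ s <;> simp [hr, hs, hz, SimpleFunc.restrict_apply]
  rw [h₂]
  conv_lhs => rw [h₁]
  rw [simpleIntegral_map, simpleIntegral_map, map_sum]
  refine Finset.sum_congr rfl fun c _ => ?_
  rw [map_smul, P.proj_proj hs (r.measurableSet_fiber c)]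
  by_cases hc : c.2
  · have : s ∩ r ⁻¹' {c} = r ⁻¹' {c} := by
      refine Set.inter_eq_right.2 fun z hz => ?_
      by_contra hzs
      have hz' : r z = c := hz
      rw [← hz'] at hc
      simp [hr, hzs] at hc
    rw [this, if_pos hc]
  · have : s ∩ r ⁻¹' {c} = ∅ := by
      refine Set.eq_empty_of_forall_notMem fun z hz => hc ?_
      have hz' : r z = c := hz.2
      rw [← hz']
      simp [hr, hz.1]
    rw [this, if_neg hc, P.proj_empty]
    simp

/-- The integral of simple functions, applied to `x`, is isometric for the norm of
`L²(⟪x, P(·) x⟫)`. -/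
theorem enorm_simpleIntegral (s : SimpleFunc α 𝕜) (x : K) :
    ‖P.simpleIntegral s x‖ₑ = eLpNorm s 2 (P.measure x) := by
  have hsq : ‖P.simpleIntegral s x‖ ^ 2 = ∑ c ∈ s.range, ‖c • P.proj (s ⁻¹' {c}) x‖ ^ 2 := by
    rw [simpleIntegral, ← inner_self_eq_norm_sq (𝕜 := 𝕜), sum_inner, map_sum]
    refine Finset.sum_congr rfl fun c hc => ?_
    rw [inner_sum, Finset.sum_eq_single c, inner_self_eq_norm_sq]
    · intro d _ hdc
      rw [inner_smul_left, inner_smul_right, P.inner_proj_left (s.measurableSet_fiber c),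
        P.proj_proj (s.measurableSet_fiber c) (s.measurableSet_fiber d)]
      have : s ⁻¹' {c} ∩ s ⁻¹' {d} = ∅ :=
        Set.eq_empty_of_forall_notMem fun z hz => hdc (hz.2.symm.trans hz.1)
      rw [this, P.proj_empty]
      simp
    · exact fun h => absurd hc h
  have h2 : ‖P.simpleIntegral s x‖ₑ ^ 2 = ∫⁻ z, ‖s z‖ₑ ^ 2 ∂(P.measure x) := by
    have h3 : ∫⁻ z, ‖s z‖ₑ ^ 2 ∂(P.measure x) =
        (s.map fun c => ‖c‖ₑ ^ 2).lintegral (P.measure x) := by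
      rw [← SimpleFunc.lintegral_eq_lintegral]
      rfl
    rw [h3, SimpleFunc.map_lintegral, ← ofReal_norm, ← ENNReal.ofReal_pow (norm_nonneg _), hsq,
      ENNReal.ofReal_sum_of_nonneg fun _ _ => sq_nonneg _]
    refine Finset.sum_congr rfl fun c _ => ?_
    rw [P.measure_apply (s.measurableSet_fiber c), ← mul_pow, ← enorm_smul,
      ENNReal.ofReal_pow (norm_nonneg _), ofReal_norm]
  rw [← eLpNorm_two_sq] at h2
  exact (ENNReal.pow_right_strictMono two_ne_zero).injective h2

theorem enorm_simpleIntegralHom (x : K) (s : SimpleFunc α 𝕜) :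
    ‖P.simpleIntegralHom x s‖ₑ = eLpNorm (SimpleFunc.coeAddHom α 𝕜 s) 2 (P.measure x) :=
  P.enorm_simpleIntegral s x

/-! ### The integral of measurable functions -/

theorem mem_integral_iff {f : α → 𝕜} {x y : K} :
    (x, y) ∈ P.integral f ↔
      IsL2Limit (P.measure x) (SimpleFunc.coeAddHom α 𝕜) (P.simpleIntegralHom x) f y := by
  refine exists_congr fun s => and_congr_left fun _ => ?_
  exact tendsto_eLpNorm_two_iff (P.measure x) fun n z => f z - s n z

theorem aestronglyMeasurable_coeAddHom (μ : Measure α) (s : SimpleFunc α 𝕜) :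
    AEStronglyMeasurable (SimpleFunc.coeAddHom α 𝕜 s) μ :=
  s.aestronglyMeasurable

variable {P} {f g : α → 𝕜} {x y z : K}

theorem integral_add (hf : Measurable f) (hg : Measurable g) (hy : (x, y) ∈ P.integral f)
    (hz : (x, z) ∈ P.integral g) : (x, y + z) ∈ P.integral (f + g) := by
  rw [mem_integral_iff] at *
  exact IsL2Limit.add (aestronglyMeasurable_coeAddHom _) hf.aestronglyMeasurable
    hg.aestronglyMeasurable hy hz

theorem integral_sub (hf : Measurable f) (hg : Measurable g) (hy : (x, y) ∈ P.integral f)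
    (hz : (x, z) ∈ P.integral g) : (x, y - z) ∈ P.integral (f - g) := by
  rw [mem_integral_iff] at *
  exact IsL2Limit.sub (aestronglyMeasurable_coeAddHom _) hf.aestronglyMeasurable
    hg.aestronglyMeasurable hy hz

theorem integral_smul (c : 𝕜) (hy : (x, y) ∈ P.integral f) :
    (x, c • y) ∈ P.integral (c • f) := by
  rw [mem_integral_iff] at *
  obtain ⟨u, h₁, h₂⟩ := hy
  refine ⟨fun n => c • u n, ?_, (h₂.const_smul c).congr fun n =>
    (P.simpleIntegral_smul c (u n) x).symm⟩
  have h := ENNReal.Tendsto.const_mul (a := ‖c‖ₑ) h₁ (Or.inr enorm_ne_top)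
  rw [mul_zero] at h
  refine h.congr fun n => ?_
  rw [← eLpNorm_const_smul, smul_sub]
  rfl

theorem integral_congr_ae (hy : (x, y) ∈ P.integral f) (h : f =ᵐ[P.measure x] g) :
    (x, y) ∈ P.integral g := by
  rw [mem_integral_iff] at *
  exact hy.congr_ae h

theorem integral_unique (hf : Measurable f) (hy : (x, y) ∈ P.integral f)
    (hz : (x, z) ∈ P.integral f) : y = z := by
  rw [mem_integral_iff] at *
  exact IsL2Limit.unique (aestronglyMeasurable_coeAddHom _) (P.enorm_simpleIntegralHom x)
    hf.aestronglyMeasurable hy hz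

theorem enorm_eq_of_mem_integral (hf : Measurable f) (hy : (x, y) ∈ P.integral f) :
    ‖y‖ₑ = eLpNorm f 2 (P.measure x) := by
  rw [mem_integral_iff] at hy
  exact IsL2Limit.enorm_eq (aestronglyMeasurable_coeAddHom _) (P.enorm_simpleIntegralHom x)
    hf.aestronglyMeasurable hy

theorem memLp_of_mem_integral (hf : Measurable f) (hy : (x, y) ∈ P.integral f) :
    MemLp f 2 (P.measure x) :=
  ⟨hf.aestronglyMeasurable, by rw [← enorm_eq_of_mem_integral hf hy]; exact enorm_lt_top⟩

theorem integral_closed (hf : Measurable f) {fs : ℕ → α → 𝕜} (hfs : ∀ n, Measurable (fs n))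
    {ys : ℕ → K} (h : ∀ n, (x, ys n) ∈ P.integral (fs n))
    (hlim : Tendsto (fun n => eLpNorm (f - fs n) 2 (P.measure x)) atTop (𝓝 0))
    (hy : Tendsto ys atTop (𝓝 y)) : (x, y) ∈ P.integral f := by
  simp only [mem_integral_iff] at *
  exact IsL2Limit.closed (aestronglyMeasurable_coeAddHom _)
    hf.aestronglyMeasurable (fun n => (hfs n).aestronglyMeasurable) h hlim hy

theorem tendsto_of_mem_integral (hf : Measurable f) {fs : ℕ → α → 𝕜}
    (hfs : ∀ n, Measurable (fs n))
    {ys : ℕ → K} (h : ∀ n, (x, ys n) ∈ P.integral (fs n)) (hy : (x, y) ∈ P.integral f)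
    (hlim : Tendsto (fun n => eLpNorm (f - fs n) 2 (P.measure x)) atTop (𝓝 0)) :
    Tendsto ys atTop (𝓝 y) := by
  simp only [mem_integral_iff] at *
  exact IsL2Limit.tendsto (aestronglyMeasurable_coeAddHom _) (P.enorm_simpleIntegralHom x)
    hf.aestronglyMeasurable (fun n => (hfs n).aestronglyMeasurable) h hy hlim

theorem simpleIntegral_mem_integral (P : ProjectionValuedMeasure 𝕜 K α) (s : SimpleFunc α 𝕜)
    (x : K) : (x, P.simpleIntegral s x) ∈ P.integral s := by
  rw [mem_integral_iff]
  exact IsL2Limit.self (φ := SimpleFunc.coeAddHom α 𝕜) (D := P.simpleIntegralHom x) s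

theorem exists_mem_integral (hf : MemLp f 2 (P.measure x)) (hm : Measurable f) :
    ∃ y, (x, y) ∈ P.integral f := by
  simp only [mem_integral_iff]
  obtain ⟨s, hs⟩ := SimpleFunc.exists_tendsto_eLpNorm_two_sub hm hf
  exact IsL2Limit.exists_of_tendsto (aestronglyMeasurable_coeAddHom _)
    (P.enorm_simpleIntegralHom x) hm.aestronglyMeasurable hs

end ProjectionValuedMeasure

namespace ProjectionValuedMeasure

variable {𝕜 K α β : Type*} [RCLike 𝕜] [NormedAddCommGroup K] [InnerProductSpace 𝕜 K]
  [CompleteSpace K] [MeasurableSpace α] [MeasurableSpace β] {P : ProjectionValuedMeasure 𝕜 K α}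
  {f g : α → 𝕜} {x y z : K}

/-! ### Calculus of the integral -/

theorem measure_proj (P : ProjectionValuedMeasure 𝕜 K α) {s : Set α} (hs : MeasurableSet s)
    (x : K) : P.measure (P.proj s x) = (P.measure x).restrict s := by
  ext t ht
  rw [P.measure_apply ht, P.proj_proj ht hs, Measure.restrict_apply ht,
    P.measure_apply (ht.inter hs)]

theorem integral_one (P : ProjectionValuedMeasure 𝕜 K α) (x : K) : (x, x) ∈ P.integral 1 := by
  classical
  have h := P.simpleIntegral_mem_integral (SimpleFunc.const α 1) x
  have h₁ : P.simpleIntegral (SimpleFunc.const α 1) x = x := by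
    rw [simpleIntegral, Finset.sum_subset (SimpleFunc.range_const_subset α (1 : 𝕜))]
    · have : (SimpleFunc.const α (1 : 𝕜)) ⁻¹' {1} = Set.univ := by ext; simp
      rw [Finset.sum_singleton, this, P.proj_univ]
      simp
    · intro c _ hc
      rw [SimpleFunc.preimage_eq_empty_iff _ _ |>.2 hc, P.proj_empty]
      simp
  rw [h₁] at h
  exact h

theorem proj_mem_integral_indicator {s : Set α} (hs : MeasurableSet s)
    (hy : (x, y) ∈ P.integral f) : (x, P.proj s y) ∈ P.integral (s.indicator f) := by
  rw [mem_integral_iff] at *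
  obtain ⟨u, h₁, h₂⟩ := hy
  refine ⟨fun n => (u n).restrict s, ?_, ?_⟩
  · refine tendsto_of_tendsto_of_tendsto_of_le_of_le tendsto_const_nhds h₁ (fun _ => zero_le)
      fun n => ?_
    have : s.indicator f - SimpleFunc.coeAddHom α 𝕜 ((u n).restrict s) =
        s.indicator (f - SimpleFunc.coeAddHom α 𝕜 (u n)) := by
      change s.indicator f - ((u n).restrict s : α → 𝕜) = s.indicator (f - (u n : α → 𝕜))
      rw [SimpleFunc.coe_restrict _ hs, Set.indicator_sub']
    change eLpNorm (s.indicator f - SimpleFunc.coeAddHom α 𝕜 ((u n).restrict s)) 2 _ ≤ _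
    rw [this]
    exact eLpNorm_indicator_le _
  · exact (((P.proj s).continuous.tendsto y).comp h₂).congr fun n =>
      P.proj_simpleIntegral hs (u n) x

/-- The scalar measure of `y = (∫ f dP) x` is `|f|²` times that of `x`. -/
theorem measure_eq_withDensity (hf : Measurable f) (hy : (x, y) ∈ P.integral f) :
    P.measure y = (P.measure x).withDensity fun z => ‖f z‖ₑ ^ 2 := by
  ext s hs
  rw [P.measure_apply hs, enorm_eq_of_mem_integral (hf.indicator hs)
    (proj_mem_integral_indicator hs hy), eLpNorm_two_sq, withDensity_apply _ hs,
    ← lintegral_indicator hs]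
  refine lintegral_congr fun z => ?_
  by_cases hz : z ∈ s <;> simp [hz]

theorem eLpNorm_measure_of_mem_integral (hf : Measurable f) (hy : (x, y) ∈ P.integral f)
    (hg : Measurable g) : eLpNorm g 2 (P.measure y) = eLpNorm (g * f) 2 (P.measure x) := by
  refine (ENNReal.pow_right_strictMono two_ne_zero).injective ?_
  simp only [eLpNorm_two_sq]
  rw [measure_eq_withDensity hf hy, lintegral_withDensity_eq_lintegral_mul _
    (hf.enorm.pow_const 2) (hg.enorm.pow_const 2)]
  refine lintegral_congr fun z => ?_
  simp only [Pi.mul_apply, enorm_mul]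
  ring

theorem simpleIntegral_mem_integral_mul (hf : Measurable f) (hy : (x, y) ∈ P.integral f)
    (s : SimpleFunc α 𝕜) : (x, P.simpleIntegral s y) ∈ P.integral (s * f) := by
  classical
  have key : ∀ F : Finset 𝕜, (x, ∑ c ∈ F, c • P.proj (s ⁻¹' {c}) y) ∈
      P.integral (∑ c ∈ F, c • (s ⁻¹' {c}).indicator f) := fun F => by
    induction F using Finset.induction_on with
    | empty =>
      simpa using integral_smul (0 : 𝕜) (P.integral_one x)
    | insert c F hc ih =>
      rw [Finset.sum_insert hc, Finset.sum_insert hc]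
      refine integral_add ?_ ?_
        (integral_smul c (proj_mem_integral_indicator (s.measurableSet_fiber c) hy)) ih
      · exact (hf.indicator (s.measurableSet_fiber c)).const_smul c
      · rw [Finset.sum_fn]
        exact Finset.measurable_sum _ fun c _ =>
          (hf.indicator (s.measurableSet_fiber c)).const_smul c
  have h := key s.range
  rwa [s.sum_smul_indicator_fiber] at h

/-- The product rule `(∫ g dP) (∫ f dP) = ∫ g f dP`, on the domain of `∫ f dP`. -/
theorem mem_integral_iff_mul_mem (hf : Measurable f) (hg : Measurable g)
    (hy : (x, y) ∈ P.integral f) : (y, z) ∈ P.integral g ↔ (x, z) ∈ P.integral (g * f) := by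
  have key : ∀ w, (y, w) ∈ P.integral g → (x, w) ∈ P.integral (g * f) := fun w hw => by
    rw [mem_integral_iff] at hw
    obtain ⟨u, h₁, h₂⟩ := hw
    refine integral_closed (hg.mul hf) (fun n => (u n).measurable.mul hf)
      (fun n => simpleIntegral_mem_integral_mul hf hy (u n)) (h₁.congr fun n => ?_) h₂
    rw [← sub_mul, ← eLpNorm_measure_of_mem_integral hf hy (hg.sub (u n).measurable)]
    rfl
  refine ⟨key z, fun hz => ?_⟩
  have hm : MemLp g 2 (P.measure y) :=
    ⟨hg.aestronglyMeasurable, by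
      rw [eLpNorm_measure_of_mem_integral hf hy hg]
      exact (memLp_of_mem_integral (hg.mul hf) hz).2⟩
  obtain ⟨w, hw⟩ := exists_mem_integral hm hg
  rw [integral_unique (hg.mul hf) hz (key w hw)]
  exact hw

/-- If the `fₙ` are dominated by `f` and tend to `f`, then `∫ f dP` is the strong limit of the
`∫ fₙ dP`, and its domain consists of the vectors on which they converge. -/
theorem mem_integral_iff_tendsto (hf : Measurable f) {fs : ℕ → α → 𝕜} (hfs : ∀ n, Measurable (fs n))
    {ys : ℕ → K} (h : ∀ n, (x, ys n) ∈ P.integral (fs n))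
    (hle : ∀ᵐ z ∂(P.measure x), ∀ n, ‖fs n z‖ ≤ ‖f z‖)
    (hlim : ∀ᵐ z ∂(P.measure x), Tendsto (fun n => fs n z) atTop (𝓝 (f z))) :
    (x, y) ∈ P.integral f ↔ Tendsto ys atTop (𝓝 y) := by
  -- dominated convergence gives one direction, Fatou's lemma bounds `∫ |f|²` for the other
  have key : ∀ w, (x, w) ∈ P.integral f → Tendsto ys atTop (𝓝 w) := fun w hw => by
    refine tendsto_of_mem_integral hf hfs h hw ?_
    rw [← tendsto_eLpNorm_two_iff]
    have hfin : ∫⁻ z, (2 * ‖f z‖ₑ) ^ 2 ∂(P.measure x) ≠ ⊤ := by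
      simp only [mul_pow]
      rw [lintegral_const_mul _ (hf.enorm.pow_const 2), ← eLpNorm_two_sq]
      exact ENNReal.mul_ne_top (by norm_num)
        (ENNReal.pow_ne_top (memLp_of_mem_integral hf hw).2.ne)
    have := tendsto_lintegral_of_dominated_convergence (μ := P.measure x)
      (F := fun n z => ‖(f - fs n) z‖ₑ ^ 2) (f := fun _ => 0) (fun z => (2 * ‖f z‖ₑ) ^ 2)
      (fun n => (hf.sub (hfs n)).enorm.pow_const 2) (fun n => ?_) hfin ?_
    · simpa using this
    · filter_upwards [hle] with z hz
      refine pow_le_pow_left' ((enorm_sub_le).trans ?_) 2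
      rw [two_mul]
      exact add_le_add_right (enorm_le_iff_norm_le.2 (hz n)) _
    · filter_upwards [hlim] with z hz
      have h1 := ((tendsto_const_nhds (x := f z)).sub hz).enorm
      have h2 := ((ENNReal.continuous_pow 2).tendsto _).comp h1
      simpa [Function.comp_def] using h2
  refine ⟨key y, fun hy => ?_⟩
  have hm : MemLp f 2 (P.measure x) := by
    refine ⟨hf.aestronglyMeasurable, ?_⟩
    refine (Lp.eLpNorm_lim_le_liminf_eLpNorm
      (fun n => (hfs n).aestronglyMeasurable) f hlim).trans_lt ?_
    have : Tendsto (fun n => eLpNorm (fs n) 2 (P.measure x)) atTop (𝓝 ‖y‖ₑ) :=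
      hy.enorm.congr fun n => enorm_eq_of_mem_integral (hfs n) (h n)
    rw [this.liminf_eq]
    exact enorm_lt_top
  obtain ⟨w, hw⟩ := exists_mem_integral hm hf
  rw [tendsto_nhds_unique hy (key w hw)]
  exact hw

/-- A strict norm inequality on the domain of `∫ f dP` holds pointwise for `f`, almost
everywhere. -/
theorem ae_norm_lt_of_forall_norm_lt (hf : Measurable f) (a b c d : 𝕜)
    (h : ∀ x y, (x, y) ∈ P.integral f → x ≠ 0 → ‖a • x + b • y‖ < ‖c • x + d • y‖) (x : K) :
    ∀ᵐ z ∂(P.measure x), ‖a + b * f z‖ < ‖c + d * f z‖ := by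
  have hN : ∀ n : ℕ, P.measure x {z | ‖f z‖ ≤ n ∧ ‖c + d * f z‖ ≤ ‖a + b * f z‖} = 0 := fun n => by
    set N := {z | ‖f z‖ ≤ n ∧ ‖c + d * f z‖ ≤ ‖a + b * f z‖} with hNdef
    have hNm : MeasurableSet N :=
      (measurableSet_le hf.norm measurable_const).inter
        (measurableSet_le (measurable_const.add (measurable_const.mul hf)).norm
          (measurable_const.add (measurable_const.mul hf)).norm)
    -- a nonzero vector in the range of `P(N)` would violate the hypothesis
    have hae : ∀ᵐ z ∂(P.measure (P.proj N x)), z ∈ N := by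
      rw [P.measure_proj hNm]
      exact ae_restrict_mem hNm
    have hm : MemLp f 2 (P.measure (P.proj N x)) :=
      MemLp.of_bound hf.aestronglyMeasurable n (hae.mono fun z hz => hz.1)
    obtain ⟨y, hy⟩ := exists_mem_integral hm hf
    have hmem : ∀ a b : 𝕜, (P.proj N x, a • P.proj N x + b • y) ∈ P.integral (a • 1 + b • f) :=
      fun a b => integral_add (measurable_const.const_smul a) (hf.const_smul b)
        (integral_smul a (P.integral_one _)) (integral_smul b hy)
    have hx0 : P.proj N x = 0 := by
      by_contra hne
      refine (h _ _ hy hne).not_ge ?_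
      rw [← enorm_le_iff_norm_le,
        enorm_eq_of_mem_integral ((measurable_const.const_smul _).add (hf.const_smul _)) (hmem c d),
        enorm_eq_of_mem_integral ((measurable_const.const_smul _).add (hf.const_smul _)) (hmem a b)]
      refine eLpNorm_mono_ae (hae.mono fun z hz => ?_)
      change ‖c * 1 + d * f z‖ ≤ ‖a * 1 + b * f z‖
      rw [mul_one, mul_one]
      exact hz.2
    rw [P.measure_apply hNm, hx0]
    simp
  have := measure_iUnion_null hN
  rw [ae_iff]
  refine measure_mono_null (fun z hz => ?_) this
  obtain ⟨n, hn⟩ := exists_nat_ge ‖f z‖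
  exact Set.mem_iUnion.2 ⟨n, hn, not_lt.1 hz⟩

/-! ### Push-forward -/

/-- The push-forward of a projection-valued measure along a measurable map. -/
def map (P : ProjectionValuedMeasure 𝕜 K α) (φ : α → β) (hφ : Measurable φ) :
    ProjectionValuedMeasure 𝕜 K β where
  proj s := P.proj (φ ⁻¹' s)
  isStarProjection s hs := P.isStarProjection _ (hφ hs)
  proj_univ := P.proj_univ
  proj_inter s t hs ht := P.proj_inter _ _ (hφ hs) (hφ ht)
  hasSum_iUnion s hs hd x := by
    rw [Set.preimage_iUnion]
    exact P.hasSum_iUnion _ (fun n => hφ (hs n)) (fun i j hij => (hd hij).preimage φ) x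

theorem measure_map {φ : α → β} (hφ : Measurable φ) (x : K) :
    (P.map φ hφ).measure x = (P.measure x).map φ := by
  ext s hs
  rw [measure_apply _ hs, Measure.map_apply hφ hs, P.measure_apply (hφ hs)]
  rfl

theorem simpleIntegral_map_comp {φ : α → β} (hφ : Measurable φ) (s : SimpleFunc β 𝕜) (x : K) :
    (P.map φ hφ).simpleIntegral s x = P.simpleIntegral (s.comp φ hφ) x := by
  refine (Finset.sum_subset (SimpleFunc.range_comp_subset_range s hφ) fun c _ hc => ?_).symm
  change c • P.proj ((s.comp φ hφ) ⁻¹' {c}) x = 0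
  rw [SimpleFunc.preimage_eq_empty_iff _ _ |>.2 hc, P.proj_empty]
  simp

theorem integral_map {φ : α → β} (hφ : Measurable φ) {f : β → 𝕜} (hf : Measurable f) :
    (P.map φ hφ).integral f = P.integral (f ∘ φ) := by
  have key : ∀ x y, (x, y) ∈ (P.map φ hφ).integral f → (x, y) ∈ P.integral (f ∘ φ) := by
    rintro x y ⟨s, h₁, h₂⟩
    refine ⟨fun n => (s n).comp φ hφ, ?_, ?_⟩
    · refine h₁.congr fun n => ?_
      rw [measure_map]
      exact lintegral_map ((hf.sub (s n).measurable).enorm.pow_const 2) hφ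
    · exact h₂.congr fun n => simpleIntegral_map_comp hφ (s n) x
  ext ⟨x, y⟩
  refine ⟨key x y, fun hy => ?_⟩
  have hm : MemLp f 2 ((P.map φ hφ).measure x) := by
    rw [measure_map, memLp_map_measure_iff hf.aestronglyMeasurable hφ.aemeasurable]
    exact memLp_of_mem_integral (hf.comp hφ) hy
  obtain ⟨w, hw⟩ := exists_mem_integral hm hf
  rw [integral_unique (hf.comp hφ) hy (key x w hw)]
  exact hw

end ProjectionValuedMeasure

/-! ### The polynomial calculus -/

open Polynomial in
/-- The polynomial calculus `p ↦ p(M)` of an operator `M`, for real polynomials `p`. -/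
def realPolyCalc {𝕜 K : Type*} [RCLike 𝕜] [NormedAddCommGroup K] [InnerProductSpace 𝕜 K]
    (M : K →L[𝕜] K) : ℝ[X] →+* (K →L[𝕜] K) :=
  (aeval M).toRingHom.comp (mapRingHom (algebraMap ℝ 𝕜))

section RealPolyCalc

open Polynomial

variable {𝕜 K : Type*} [RCLike 𝕜] [NormedAddCommGroup K] [InnerProductSpace 𝕜 K] (M : K →L[𝕜] K)

theorem realPolyCalc_X : realPolyCalc M X = M := by
  simp [realPolyCalc]

theorem realPolyCalc_C_apply (c : ℝ) (x : K) : realPolyCalc M (C c) x = (c : 𝕜) • x := by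
  simp [realPolyCalc, Algebra.algebraMap_eq_smul_one]

theorem inner_realPolyCalc_left [CompleteSpace K] {M : K →L[𝕜] K} (hM : IsSelfAdjoint M)
    (p : ℝ[X]) (x y : K) :
    inner 𝕜 (realPolyCalc M p x) y = inner 𝕜 x (realPolyCalc M p y) := by
  have key : ∀ n (x y : K), inner 𝕜 ((M ^ n) x) y = inner 𝕜 x ((M ^ n) y) := fun n x y => by
    rw [← ContinuousLinearMap.adjoint_inner_right, ← ContinuousLinearMap.star_eq_adjoint,
      (hM.pow n).star_eq]
  induction p using Polynomial.induction_on' with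
  | add p q hp hq => simp [inner_add_left, inner_add_right, hp, hq]
  | monomial n c =>
    rw [← C_mul_X_pow_eq_monomial, map_mul, map_pow, realPolyCalc_X]
    simp only [mul_apply_eq_comp, realPolyCalc_C_apply, inner_smul_left,
      inner_smul_right, key, RCLike.conj_ofReal]

/-- Evaluation of real polynomials, as an additive map to functions. -/
def polyEval : ℝ[X] →+ ℝ → ℝ :=
  AddMonoidHom.mk' (fun p t => p.eval t) fun p q => by ext; simp

/-- The vectors `p(M) x`, as an additive function of `p`. -/
def polyApply (x : K) : ℝ[X] →+ K :=
  AddMonoidHom.mk' (fun p => realPolyCalc M p x) fun p q => by simp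

theorem aestronglyMeasurable_polyEval (μ : Measure ℝ) (p : ℝ[X]) :
    AEStronglyMeasurable (polyEval p) μ :=
  p.continuous.aestronglyMeasurable

end RealPolyCalc

/-! ### Density of polynomials in `L²` -/

open Polynomial in
theorem exists_tendsto_polyEval (ν : Measure ℝ) [IsFiniteMeasure ν] {R : ℝ}
    (hν : ∀ᵐ t ∂ν, t ∈ Set.Icc (-R) R) {f : ℝ → ℝ} (hf : MemLp f 2 ν) :
    ∃ p : ℕ → ℝ[X], Tendsto (fun n => eLpNorm (f - polyEval (p n)) 2 ν) atTop (𝓝 0) := by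
  have key : ∀ ε : NNReal, 0 < ε → ∃ p : ℝ[X],
      eLpNorm (f - polyEval p) 2 ν ≤ ε + ν Set.univ ^ (1 / 2 : ℝ) * ε := fun ε hε => by
    obtain ⟨g, hg, hgm⟩ := hf.exists_boundedContinuous_eLpNorm_sub_le (by norm_num)
      (ε := ε) (by simpa using hε.ne')
    obtain ⟨p, hp⟩ := exists_polynomial_near_of_continuousOn (-R) R g g.continuous.continuousOn ε hε
    refine ⟨p, ?_⟩
    have : f - polyEval p = (f - g) + ((g : ℝ → ℝ) - polyEval p) := by abel
    rw [this]
    refine (eLpNorm_add_le (hf.1.sub hgm.1) (hgm.1.sub (aestronglyMeasurable_polyEval ν p))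
      (by norm_num)).trans (add_le_add hg ?_)
    refine (eLpNorm_le_of_ae_bound (C := ε) ?_).trans (by simp)
    filter_upwards [hν] with t ht
    rw [Pi.sub_apply, norm_sub_rev]
    exact (hp t ht).le
  choose p hp using fun n : ℕ => key (1 / (n + 1)) (by positivity)
  refine ⟨p, ?_⟩
  have h0 : Tendsto (fun n : ℕ => ((1 / (n + 1) : NNReal) : ENNReal)) atTop (𝓝 0) :=
    ENNReal.tendsto_coe.2 tendsto_one_div_add_atTop_nhds_zero_nat
  have h1 := h0.add (ENNReal.Tendsto.const_mul (a := ν Set.univ ^ (1 / 2 : ℝ)) h0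
    (Or.inr (by finiteness)))
  rw [mul_zero, add_zero] at h1
  exact tendsto_of_tendsto_of_tendsto_of_le_of_le tendsto_const_nhds h1 (fun _ => zero_le) hp

/-! ### The spectral measure of a bounded selfadjoint operator -/

/-- The scalar spectral measures of a bounded operator `M`: finite measures `μ x`, carried by a
bounded interval, with `∫ p dμ x = ⟪x, p(M) x⟫` for the real polynomials `p`. -/
structure IsScalarSpectralFamily {𝕜 K : Type*} [RCLike 𝕜] [NormedAddCommGroup K]
    [InnerProductSpace 𝕜 K] (M : K →L[𝕜] K) (R : ℝ) (μ : K → Measure ℝ) : Prop where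
  finite : ∀ x, IsFiniteMeasure (μ x)
  ae_mem : ∀ x, ∀ᵐ t ∂(μ x), t ∈ Set.Icc (-R) R
  integral_eq : ∀ x (p : Polynomial ℝ),
    ∫ t, p.eval t ∂(μ x) = RCLike.re (inner 𝕜 x (realPolyCalc M p x))

namespace IsScalarSpectralFamily

open Polynomial

variable {𝕜 K : Type*} [RCLike 𝕜] [NormedAddCommGroup K] [InnerProductSpace 𝕜 K]
  {M : K →L[𝕜] K} {R : ℝ} {μ : K → Measure ℝ}

theorem exists_bound (h : IsScalarSpectralFamily M R μ) (p : ℝ[X]) :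
    ∃ C, ∀ x, ∀ᵐ t ∂(μ x), ‖p.eval t‖ ≤ C := by
  obtain ⟨C, hC⟩ := (isCompact_Icc (a := -R) (b := R)).exists_bound_of_continuousOn
    p.continuous.continuousOn
  exact ⟨C, fun x => (h.ae_mem x).mono hC⟩

/-- `y = f(M) x`: the vector `y` is the limit of `pₙ(M) x` for polynomials `pₙ → f` in
`L²(μ x)`. -/
def IsValue (M : K →L[𝕜] K) (μ : K → Measure ℝ) (f : ℝ → ℝ) (x y : K) : Prop :=
  IsL2Limit (μ x) polyEval (polyApply M x) f y

variable {f : ℝ → ℝ} {x y z : K}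

theorem isValue_add {g : ℝ → ℝ} (hf : Measurable f) (hg : Measurable g)
    (hy : IsValue M μ f x y) (hz : IsValue M μ g x z) : IsValue M μ (f + g) x (y + z) :=
  IsL2Limit.add (aestronglyMeasurable_polyEval _) hf.aestronglyMeasurable
    hg.aestronglyMeasurable hy hz

theorem isValue_poly (x : K) (p : ℝ[X]) : IsValue M μ (polyEval p) x (realPolyCalc M p x) :=
  IsL2Limit.self (φ := polyEval) (D := polyApply M x) p

theorem isValue_poly_mul (h : IsScalarSpectralFamily M R μ) (p : ℝ[X])
    (hy : IsValue M μ f x y) : IsValue M μ (polyEval p * f) x (realPolyCalc M p y) := by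
  obtain ⟨u, h₁, h₂⟩ := hy
  obtain ⟨C, hC⟩ := h.exists_bound p
  refine ⟨fun n => p * u n, ?_, ?_⟩
  · have h₃ := ENNReal.Tendsto.const_mul (a := ENNReal.ofReal C) h₁ (Or.inr ENNReal.ofReal_ne_top)
    rw [mul_zero] at h₃
    refine tendsto_of_tendsto_of_tendsto_of_le_of_le tendsto_const_nhds h₃ (fun _ => zero_le)
      fun n => eLpNorm_le_mul_eLpNorm_of_ae_le_mul ?_ 2
    filter_upwards [hC x] with t ht
    have : (polyEval p * f - polyEval (p * u n)) t = p.eval t * (f - polyEval (u n)) t := by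
      simp [polyEval, mul_sub]
    rw [this, norm_mul]
    exact mul_le_mul_of_nonneg_right ht (norm_nonneg _)
  · refine (((realPolyCalc M p).continuous.tendsto y).comp h₂).congr fun n => ?_
    simp [polyApply]

theorem isValue_smul (h : IsScalarSpectralFamily M R μ) (c : ℝ)
    (hy : IsValue M μ f x y) : IsValue M μ (c • f) x ((c : 𝕜) • y) := by
  have := h.isValue_poly_mul (C c) hy
  rw [realPolyCalc_C_apply] at this
  convert this using 1
  ext t
  simp [polyEval]

theorem memLp_indicator (h : IsScalarSpectralFamily M R μ) {s : Set ℝ} (hs : MeasurableSet s)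
    (x : K) : MemLp (s.indicator (1 : ℝ → ℝ)) 2 (μ x) := by
  have := h.finite x
  exact (memLp_const (1 : ℝ)).indicator hs

theorem measurable_indicator_one {s : Set ℝ} (hs : MeasurableSet s) :
    Measurable (s.indicator (1 : ℝ → ℝ)) :=
  measurable_one.indicator hs

variable [CompleteSpace K]

theorem enorm_polyApply (h : IsScalarSpectralFamily M R μ) (hM : IsSelfAdjoint M) (x : K)
    (p : ℝ[X]) : ‖polyApply M x p‖ₑ = eLpNorm (polyEval p) 2 (μ x) := by
  have := h.finite x
  refine (ENNReal.pow_right_strictMono two_ne_zero).injective ?_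
  simp only [eLpNorm_two_sq]
  have h₁ : ‖polyApply M x p‖ ^ 2 = ∫ t, (p * p).eval t ∂(μ x) := by
    rw [h.integral_eq, map_mul, mul_apply_eq_comp, ← inner_realPolyCalc_left hM,
      inner_self_eq_norm_sq]
    rfl
  rw [← ofReal_norm, ← ENNReal.ofReal_pow (norm_nonneg _), h₁,
    ofReal_integral_eq_lintegral_ofReal]
  · refine lintegral_congr fun t => ?_
    rw [eval_mul, ← sq, ← sq_abs, ENNReal.ofReal_pow (abs_nonneg _), ← Real.norm_eq_abs,
      ofReal_norm]
    rfl
  · obtain ⟨C, hC⟩ := h.exists_bound (p * p)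
    exact Integrable.of_bound (p * p).continuous.aestronglyMeasurable C (hC x)
  · exact Eventually.of_forall fun t => by simpa using mul_self_nonneg _

theorem exists_isValue (h : IsScalarSpectralFamily M R μ) (hM : IsSelfAdjoint M)
    (hf : MemLp f 2 (μ x)) : ∃ y, IsValue M μ f x y := by
  have := h.finite x
  obtain ⟨p, hp⟩ := exists_tendsto_polyEval (μ x) (h.ae_mem x) hf
  exact IsL2Limit.exists_of_tendsto (aestronglyMeasurable_polyEval _) (h.enorm_polyApply hM x)
    hf.1 hp

theorem isValue_unique (h : IsScalarSpectralFamily M R μ) (hM : IsSelfAdjoint M)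
    (hf : Measurable f) (hy : IsValue M μ f x y) (hz : IsValue M μ f x z) : y = z :=
  IsL2Limit.unique (aestronglyMeasurable_polyEval _) (h.enorm_polyApply hM x)
    hf.aestronglyMeasurable hy hz

open Classical in
/-- The vector `1_s(M) x`, for measurable `s`. -/
def projVec (h : IsScalarSpectralFamily M R μ) (hM : IsSelfAdjoint M) (s : Set ℝ) (x : K) : K :=
  if hs : MeasurableSet s then (h.exists_isValue hM (h.memLp_indicator hs x)).choose else 0

section projVec

variable (h : IsScalarSpectralFamily M R μ) (hM : IsSelfAdjoint M) {s t : Set ℝ}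

theorem isValue_projVec (hs : MeasurableSet s) (x : K) :
    IsValue M μ (s.indicator 1) x (h.projVec hM s x) := by
  rw [projVec, dif_pos hs]
  exact (h.exists_isValue hM (h.memLp_indicator hs x)).choose_spec

theorem projVec_eq (hs : MeasurableSet s) (hy : IsValue M μ (s.indicator 1) x y) :
    h.projVec hM s x = y :=
  h.isValue_unique hM (measurable_indicator_one hs) (h.isValue_projVec hM hs x) hy

theorem measure_eq_enorm_projVec (hs : MeasurableSet s) (x : K) :
    μ x s = ‖h.projVec hM s x‖ₑ ^ 2 := by
  rw [IsL2Limit.enorm_eq (aestronglyMeasurable_polyEval _) (h.enorm_polyApply hM x)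
    (measurable_indicator_one hs).aestronglyMeasurable (h.isValue_projVec hM hs x), eLpNorm_two_sq,
    ← lintegral_indicator_one hs]
  refine lintegral_congr fun t => ?_
  by_cases ht : t ∈ s <;> simp [ht]

/-- Polynomials approximating `1_s` in `L²(μ x + μ y + μ z)` compute `1_s(M)` on `x`, `y`
and `z`. -/
theorem exists_common_approx (hs : MeasurableSet s) (x y z : K) : ∃ p : ℕ → ℝ[X],
    Tendsto (fun n => eLpNorm (s.indicator 1 - polyEval (p n)) 2 (μ x)) atTop (𝓝 0) ∧
    Tendsto (fun n => realPolyCalc M (p n) x) atTop (𝓝 (h.projVec hM s x)) ∧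
    Tendsto (fun n => realPolyCalc M (p n) y) atTop (𝓝 (h.projVec hM s y)) ∧
    Tendsto (fun n => realPolyCalc M (p n) z) atTop (𝓝 (h.projVec hM s z)) := by
  have hx := h.finite x
  have hy := h.finite y
  have hz := h.finite z
  obtain ⟨p, hp⟩ := exists_tendsto_polyEval (μ x + μ y + μ z) (R := R)
    (ae_add_measure_iff.2 ⟨ae_add_measure_iff.2 ⟨h.ae_mem x, h.ae_mem y⟩, h.ae_mem z⟩)
    (f := s.indicator 1) ((memLp_const (1 : ℝ)).indicator hs)
  have h₁ : ∀ w, μ w ≤ μ x + μ y + μ z →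
      Tendsto (fun n => eLpNorm (s.indicator 1 - polyEval (p n)) 2 (μ w)) atTop (𝓝 0) :=
    fun w hw => tendsto_of_tendsto_of_tendsto_of_le_of_le tendsto_const_nhds hp (fun _ => zero_le)
      fun n => eLpNorm_mono_measure _ hw
  have h₂ : ∀ w, μ w ≤ μ x + μ y + μ z →
      Tendsto (fun n => realPolyCalc M (p n) w) atTop (𝓝 (h.projVec hM s w)) := fun w hw =>
    IsL2Limit.tendsto (aestronglyMeasurable_polyEval _) (h.enorm_polyApply hM w)
      (measurable_indicator_one hs).aestronglyMeasurable
      (fun n => aestronglyMeasurable_polyEval _ (p n)) (fun n => isValue_poly w (p n))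
      (h.isValue_projVec hM hs w) (h₁ w hw)
  have hx' : μ x ≤ μ x + μ y + μ z := by
    rw [add_assoc]
    exact Measure.le_add_right le_rfl
  have hy' : μ y ≤ μ x + μ y + μ z :=
    Measure.le_add_right (Measure.le_add_left le_rfl)
  exact ⟨p, h₁ x hx', h₂ x hx', h₂ y hy', h₂ z (Measure.le_add_left le_rfl)⟩

theorem projVec_add_vec (hs : MeasurableSet s) (x y : K) :
    h.projVec hM s (x + y) = h.projVec hM s x + h.projVec hM s y := by
  obtain ⟨p, -, hx, hy, hxy⟩ := h.exists_common_approx hM hs x y (x + y)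
  exact tendsto_nhds_unique hxy (by simpa using hx.add hy)

theorem projVec_smul_vec (hs : MeasurableSet s) (c : 𝕜) (x : K) :
    h.projVec hM s (c • x) = c • h.projVec hM s x := by
  obtain ⟨p, -, hx, hy, -⟩ := h.exists_common_approx hM hs x (c • x) 0
  exact tendsto_nhds_unique hy (by simpa using hx.const_smul c)

theorem inner_projVec_left (hs : MeasurableSet s) (x y : K) :
    inner 𝕜 (h.projVec hM s x) y = inner 𝕜 x (h.projVec hM s y) := by
  obtain ⟨p, -, hx, hy, -⟩ := h.exists_common_approx hM hs x y 0
  refine tendsto_nhds_unique (hx.inner tendsto_const_nhds)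
    ((tendsto_const_nhds.inner hy).congr fun n => ?_)
  rw [inner_realPolyCalc_left hM]

theorem projVec_projVec (hs : MeasurableSet s) (ht : MeasurableSet t) (x : K) :
    h.projVec hM s (h.projVec hM t x) = h.projVec hM (s ∩ t) x := by
  obtain ⟨p, hp, -, hy, -⟩ := h.exists_common_approx hM hs x (h.projVec hM t x) 0
  refine (h.projVec_eq hM (hs.inter ht) ?_).symm
  refine IsL2Limit.closed (aestronglyMeasurable_polyEval _)
    (measurable_indicator_one (hs.inter ht)).aestronglyMeasurable
    (fun n => (aestronglyMeasurable_polyEval _ (p n)).mul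
      (measurable_indicator_one ht).aestronglyMeasurable)
    (fun n => h.isValue_poly_mul (p n) (h.isValue_projVec hM ht x)) ?_ hy
  refine tendsto_of_tendsto_of_tendsto_of_le_of_le tendsto_const_nhds hp (fun _ => zero_le)
    fun n => eLpNorm_mono fun r => ?_
  by_cases hr : r ∈ t <;> by_cases hr' : r ∈ s <;> simp [hr, hr']

theorem projVec_union (hs : MeasurableSet s) (ht : MeasurableSet t) (hd : Disjoint s t) (x : K) :
    h.projVec hM (s ∪ t) x = h.projVec hM s x + h.projVec hM t x := by
  refine h.projVec_eq hM (hs.union ht) ?_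
  rw [Set.indicator_union_of_disjoint hd]
  exact isValue_add (measurable_indicator_one hs) (measurable_indicator_one ht)
    (h.isValue_projVec hM hs x) (h.isValue_projVec hM ht x)

theorem projVec_univ (x : K) : h.projVec hM Set.univ x = x := by
  refine h.projVec_eq hM MeasurableSet.univ ?_
  have := isValue_poly (M := M) (μ := μ) x 1
  have h₁ : polyEval (1 : ℝ[X]) = Set.univ.indicator 1 := by
    ext t
    simp [polyEval]
  rw [h₁, map_one] at this
  exact this

theorem projVec_biUnion_finset {s : ℕ → Set ℝ} (hs : ∀ n, MeasurableSet (s n))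
    (hd : Pairwise (Function.onFun Disjoint s)) (F : Finset ℕ) (x : K) :
    h.projVec hM (⋃ n ∈ F, s n) x = ∑ n ∈ F, h.projVec hM (s n) x := by
  classical
  induction F using Finset.induction_on with
  | empty =>
    have := h.measure_eq_enorm_projVec hM MeasurableSet.empty x
    rw [measure_empty, eq_comm, pow_eq_zero_iff two_ne_zero, enorm_eq_zero] at this
    simpa using this
  | insert n F hn ih =>
    rw [Finset.set_biUnion_insert, h.projVec_union hM (hs n)
      (Finset.measurableSet_biUnion _ fun m _ => hs m) _ x, Finset.sum_insert hn, ih]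
    refine Set.disjoint_iUnion₂_right.2 fun m hm => hd ?_
    rintro rfl
    exact hn hm

theorem hasSum_projVec {s : ℕ → Set ℝ} (hs : ∀ n, MeasurableSet (s n))
    (hd : Pairwise (Function.onFun Disjoint s)) (x : K) :
    HasSum (fun n => h.projVec hM (s n) x) (h.projVec hM (⋃ n, s n) x) := by
  have hfin := h.finite x
  have h₀ : Tendsto (fun F : Finset ℕ => ∑' n : {n // n ∉ F}, μ x (s n)) atTop (𝓝 0) := by
    refine ENNReal.tendsto_tsum_compl_atTop_zero (f := fun n => μ x (s n)) ?_
    rw [← measure_iUnion hd hs]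
    exact measure_ne_top _ _
  have hU : ∀ F : Finset ℕ, MeasurableSet (⋃ n ∈ F, s n) := fun F =>
    Finset.measurableSet_biUnion _ fun m _ => hs m
  have hV : ∀ F : Finset ℕ, MeasurableSet (⋃ n : {n // n ∉ F}, s n) := fun F =>
    MeasurableSet.iUnion fun n => hs n
  have h₁ : ∀ F : Finset ℕ, h.projVec hM (⋃ n, s n) x =
      ∑ n ∈ F, h.projVec hM (s n) x + h.projVec hM (⋃ n : {n // n ∉ F}, s n) x := fun F => by
    rw [← h.projVec_biUnion_finset hM hs hd, ← h.projVec_union hM (hU F) (hV F)]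
    · congr 1
      ext t
      simp only [Set.mem_iUnion, Set.mem_union, Subtype.exists, exists_prop]
      constructor
      · rintro ⟨n, hn⟩
        by_cases hF : n ∈ F
        · exact Or.inl ⟨n, hF, hn⟩
        · exact Or.inr ⟨n, hF, hn⟩
      · rintro (⟨n, -, hn⟩ | ⟨n, -, hn⟩) <;> exact ⟨n, hn⟩
    · refine Set.disjoint_iUnion₂_left.2 fun m hm => Set.disjoint_iUnion_right.2 fun n => hd ?_
      rintro rfl
      exact n.2 hm
  rw [HasSum, SummationFilter.unconditional_filter, tendsto_iff_edist_tendsto_0]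
  have h₂ : ∀ F : Finset ℕ, edist (∑ n ∈ F, h.projVec hM (s n) x) (h.projVec hM (⋃ n, s n) x) ^ 2 ≤
      ∑' n : {n // n ∉ F}, μ x (s n) := fun F => by
    rw [edist_comm, edist_eq_enorm_sub, h₁ F, add_sub_cancel_left,
      ← h.measure_eq_enorm_projVec hM (hV F)]
    exact measure_iUnion_le _
  have h₃ := tendsto_of_tendsto_of_tendsto_of_le_of_le tendsto_const_nhds h₀ (fun _ => zero_le) h₂
  exact ENNReal.tendsto_zero_of_sq h₃

theorem norm_projVec_le (hs : MeasurableSet s) (x : K) : ‖h.projVec hM s x‖ ≤ ‖x‖ := by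
  rw [← enorm_le_iff_norm_le, ← ENNReal.pow_le_pow_left_iff two_ne_zero,
    ← h.measure_eq_enorm_projVec hM hs]
  conv_rhs => rw [← h.projVec_univ hM x]
  rw [← h.measure_eq_enorm_projVec hM MeasurableSet.univ]
  exact measure_mono (Set.subset_univ _)

open Classical in
/-- The operator `1_s(M)`. -/
def projCLM (s : Set ℝ) : K →L[𝕜] K :=
  if hs : MeasurableSet s then
    LinearMap.mkContinuous
      { toFun := h.projVec hM s
        map_add' := h.projVec_add_vec hM hs
        map_smul' := h.projVec_smul_vec hM hs } 1
      fun x => by simpa using h.norm_projVec_le hM hs x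
  else 0

theorem projCLM_apply (hs : MeasurableSet s) (x : K) : h.projCLM hM s x = h.projVec hM s x := by
  rw [projCLM, dif_pos hs]
  rfl

/-- The projection-valued measure `s ↦ 1_s(M)`. -/
def pvm : ProjectionValuedMeasure 𝕜 K ℝ where
  proj := h.projCLM hM
  isStarProjection s hs := by
    constructor
    · ext x
      rw [mul_apply_eq_comp, h.projCLM_apply hM hs, h.projCLM_apply hM hs,
        h.projVec_projVec hM hs hs, Set.inter_self]
    · rw [ContinuousLinearMap.isSelfAdjoint_iff_isSymmetric]
      intro x y
      simpa [h.projCLM_apply hM hs] using h.inner_projVec_left hM hs x y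
  proj_univ := by
    ext x
    rw [h.projCLM_apply hM MeasurableSet.univ, h.projVec_univ]
    rfl
  proj_inter s t hs ht := by
    ext x
    rw [mul_apply_eq_comp, h.projCLM_apply hM hs, h.projCLM_apply hM ht,
      h.projCLM_apply hM (hs.inter ht), h.projVec_projVec hM hs ht]
  hasSum_iUnion s hs hd x := by
    simpa [h.projCLM_apply hM, hs, MeasurableSet.iUnion hs] using h.hasSum_projVec hM hs hd x

theorem measure_pvm (x : K) : (h.pvm hM).measure x = μ x := by
  ext s hs
  rw [ProjectionValuedMeasure.measure_apply _ hs, h.measure_eq_enorm_projVec hM hs,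
    ← h.projCLM_apply hM hs]
  rfl

theorem isValue_simpleFunc (r : SimpleFunc ℝ ℝ) (x : K) :
    IsValue M μ r x ((h.pvm hM).simpleIntegral (r.map (RCLike.ofReal (K := 𝕜))) x) := by
  classical
  rw [ProjectionValuedMeasure.simpleIntegral_map]
  have key : ∀ F : Finset ℝ, IsValue M μ (∑ c ∈ F, c • (r ⁻¹' {c}).indicator 1) x
      (∑ c ∈ F, (c : 𝕜) • (h.pvm hM).proj (r ⁻¹' {c}) x) := fun F => by
    induction F using Finset.induction_on with
    | empty =>
      have := isValue_poly (M := M) (μ := μ) x 0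
      simpa using this
    | insert c F hc ih =>
      rw [Finset.sum_insert hc, Finset.sum_insert hc]
      refine isValue_add ((measurable_indicator_one (r.measurableSet_fiber c)).const_smul c) ?_
        (h.isValue_smul c ?_) ih
      · rw [Finset.sum_fn]
        exact Finset.measurable_sum _ fun c _ =>
          (measurable_indicator_one (r.measurableSet_fiber c)).const_smul c
      · have := h.isValue_projVec hM (r.measurableSet_fiber c) x
        rwa [← h.projCLM_apply hM (r.measurableSet_fiber c)] at this
  have := key r.range
  rwa [r.sum_smul_indicator_fiber, mul_one] at this

theorem mem_integral_of_isValue (hf : Measurable f) (hf2 : MemLp f 2 (μ x))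
    (hy : IsValue M μ f x y) : (x, y) ∈ (h.pvm hM).integral (fun t => (f t : 𝕜)) := by
  obtain ⟨r, h₂⟩ := SimpleFunc.exists_tendsto_eLpNorm_two_sub hf hf2
  refine ProjectionValuedMeasure.integral_closed (by fun_prop)
    (fun n => ((r n).map (RCLike.ofReal (K := 𝕜))).measurable)
    (fun n => (h.pvm hM).simpleIntegral_mem_integral ((r n).map (RCLike.ofReal (K := 𝕜))) x) ?_
    (IsL2Limit.tendsto (aestronglyMeasurable_polyEval _) (h.enorm_polyApply hM x)
      hf.aestronglyMeasurable (fun n => (r n).aestronglyMeasurable)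
      (fun n => h.isValue_simpleFunc hM (r n) x) hy h₂)
  rw [h.measure_pvm]
  refine h₂.congr fun n => eLpNorm_congr_norm_ae (Eventually.of_forall fun t => ?_)
  simp only [Pi.sub_apply, SimpleFunc.coe_map, Function.comp]
  rw [← RCLike.ofReal_sub, RCLike.norm_ofReal, Real.norm_eq_abs]

theorem mem_integral_id_pvm (x : K) :
    (x, M x) ∈ (h.pvm hM).integral (fun t => (t : 𝕜)) := by
  have h₁ := isValue_poly (M := M) (μ := μ) x X
  rw [realPolyCalc_X] at h₁
  have h₂ : polyEval X = fun t => t := by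
    ext t
    simp [polyEval]
  rw [h₂] at h₁
  have := h.finite x
  refine h.mem_integral_of_isValue hM measurable_id ?_ h₁
  exact MemLp.of_bound measurable_id.aestronglyMeasurable R
    ((h.ae_mem x).mono fun t ht => abs_le.2 ht)

end projVec

end IsScalarSpectralFamily

/-! ### Existence of the scalar spectral measures -/

open Polynomial CompactlySupported in
/-- On a complex Hilbert space the scalar spectral measures come from the continuous functional
calculus by the Riesz–Markov–Kakutani theorem. -/
theorem exists_isScalarSpectralFamily_complex {K : Type*} [NormedAddCommGroup K]
    [InnerProductSpace ℂ K] [CompleteSpace K] {M : K →L[ℂ] K} (hM : IsSelfAdjoint M) :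
    ∃ R μ, IsScalarSpectralFamily M R μ := by
  have key : ∀ x : K, ∃ μ : Measure ℝ, IsFiniteMeasure μ ∧
      (∀ᵐ t ∂μ, t ∈ Set.Icc (-(‖M‖ * ‖(1 : K →L[ℂ] K)‖)) (‖M‖ * ‖(1 : K →L[ℂ] K)‖)) ∧
      ∀ p : ℝ[X], ∫ t, p.eval t ∂μ = RCLike.re (inner ℂ x (realPolyCalc M p x)) := fun x => by
    let Λ₀ : C_c(spectrum ℝ M, ℝ) →ₗ[ℝ] ℝ :=
      { toFun := fun f => RCLike.re (inner ℂ x (cfcHom hM (f : C(spectrum ℝ M, ℝ)) x))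
        map_add' := fun f g => by
          have : ((f + g : C_c(spectrum ℝ M, ℝ)) : C(spectrum ℝ M, ℝ)) = f + g := rfl
          rw [this, map_add]
          simp
        map_smul' := fun c f => by
          have : ((c • f : C_c(spectrum ℝ M, ℝ)) : C(spectrum ℝ M, ℝ)) = c • f := rfl
          rw [this, map_smul]
          change RCLike.re (inner ℂ x (c • cfcHom hM (f : C(spectrum ℝ M, ℝ)) x)) = _
          rw [RCLike.real_smul_eq_coe_smul (K := ℂ), inner_smul_right]
          simp }
    let Λ : C_c(spectrum ℝ M, ℝ) →ₚ[ℝ] ℝ := PositiveLinearMap.mk₀ Λ₀ fun f hf => by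
      have hpos : (cfcHom hM (f : C(spectrum ℝ M, ℝ))).IsPositive := by
        rw [← ContinuousLinearMap.nonneg_iff_isPositive]
        exact (cfcHom_nonneg_iff hM).2 hf
      exact hpos.re_inner_nonneg_right x
    refine ⟨(RealRMK.rieszMeasure Λ).map Subtype.val, inferInstance, ?_, fun p => ?_⟩
    · refine (ae_map_iff measurable_subtype_coe.aemeasurable measurableSet_Icc).2 ?_
      refine Eventually.of_forall fun t => ?_
      have := spectrum.norm_le_norm_mul_of_mem t.2
      exact abs_le.1 this
    · rw [integral_map measurable_subtype_coe.aemeasurable p.continuous.aestronglyMeasurable]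
      have h := RealRMK.integral_rieszMeasure Λ
        (CompactlySupportedContinuousMap.continuousMapEquiv
          ⟨fun t : spectrum ℝ M => p.eval (t : ℝ), by fun_prop⟩)
      refine h.trans ?_
      change RCLike.re (inner ℂ x (cfcHom hM (_ : C(spectrum ℝ M, ℝ)) x)) = _
      have h₁ : realPolyCalc M p = aeval M p := aeval_map_algebraMap ℂ M p
      rw [h₁, ← cfc_polynomial p M hM, cfc_apply _ M hM p.continuous.continuousOn]
      rfl
  choose μ h₁ h₂ h₃ using key
  exact ⟨_, μ, h₁, h₂, h₃⟩

/-! ### Bounded operators on the complexification -/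

namespace Complexification

variable {H : Type*} [NormedAddCommGroup H] [InnerProductSpace ℝ H]

@[simp] theorem re_mapCLM (A : H →L[ℝ] H) (x : Complexification H) :
    (mapCLM A x).re = A x.re := rfl

@[simp] theorem im_mapCLM (A : H →L[ℝ] H) (x : Complexification H) :
    (mapCLM A x).im = A x.im := rfl

theorem inner_def (x y : Complexification H) : inner ℂ x y =
    ⟨inner ℝ x.re y.re + inner ℝ x.im y.im, inner ℝ x.re y.im - inner ℝ x.im y.re⟩ := rfl

theorem adjoint_mapCLM [CompleteSpace H] (A : H →L[ℝ] H) :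
    ContinuousLinearMap.adjoint (mapCLM A) = mapCLM (ContinuousLinearMap.adjoint A) := by
  symm
  rw [ContinuousLinearMap.eq_adjoint_iff]
  intro x y
  simp [inner_def, ContinuousLinearMap.adjoint_inner_left]

theorem realPolyCalc_mapCLM (A : H →L[ℝ] H) (p : Polynomial ℝ) (x : H) :
    realPolyCalc (mapCLM A) p (mk x 0) = mk (realPolyCalc A p x) 0 := by
  induction p using Polynomial.induction_on' with
  | add p q hp hq =>
    rw [map_add, map_add, add_apply, add_apply, hp, hq]
    ext <;> simp
  | monomial n c =>
    have key : (mapCLM A ^ n) (mk x 0) = mk ((A ^ n) x) 0 := by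
      induction n with
      | zero => rfl
      | succ n ih =>
        rw [pow_succ', pow_succ', mul_apply_eq_comp, ih]
        ext <;> simp
    rw [← Polynomial.C_mul_X_pow_eq_monomial, map_mul, map_mul, map_pow, map_pow, realPolyCalc_X,
      realPolyCalc_X, mul_apply_eq_comp, mul_apply_eq_comp, realPolyCalc_C_apply,
      realPolyCalc_C_apply, key]
    ext <;> simp only [re_smul, im_smul, re_mk, im_mk] <;> simp

end Complexification

/-- On a real Hilbert space, where no continuous functional calculus is available, the scalar
spectral measures of `M` are those of its complexification at the real vectors. -/
theorem exists_isScalarSpectralFamily_real {H : Type*} [NormedAddCommGroup H]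
    [InnerProductSpace ℝ H] [CompleteSpace H] {M : H →L[ℝ] H} (hM : IsSelfAdjoint M) :
    ∃ R μ, IsScalarSpectralFamily M R μ := by
  have hM' : IsSelfAdjoint (Complexification.mapCLM M) := by
    rw [IsSelfAdjoint, ContinuousLinearMap.star_eq_adjoint, Complexification.adjoint_mapCLM,
      ← ContinuousLinearMap.star_eq_adjoint, hM.star_eq]
  obtain ⟨R, μ, h⟩ := exists_isScalarSpectralFamily_complex hM'
  refine ⟨R, fun x => μ (.mk x 0), fun x => h.finite _, fun x => h.ae_mem _, fun x p => ?_⟩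
  rw [h.integral_eq, Complexification.realPolyCalc_mapCLM]
  simp [Complexification.inner_def]

/-! ### The power series of the inverse hyperbolic tangent -/

/-- The power series of `artanh y`, written as `(log (1 + y) - log (1 - y)) / 2`. -/
theorem hasSum_artanh_series {y : ℝ} (hy : |y| < 1) :
    HasSum (fun k : ℕ => y ^ (2 * k + 1) / (2 * k + 1))
      ((Real.log (1 + y) - Real.log (1 - y)) / 2) := by
  have h := (Real.hasSum_log_sub_log_of_abs_lt_one hy).div_const 2
  refine h.congr_fun ?_
  intro k
  ring

/-- All terms of the series have the same sign, so its partial sums are dominated by the sum. -/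
theorem abs_artanh_partialSum_le {y : ℝ} (hy : |y| < 1) (n : ℕ) :
    |∑ k ∈ Finset.range n, y ^ (2 * k + 1) / (2 * k + 1)| ≤
      |(Real.log (1 + y) - Real.log (1 - y)) / 2| := by
  have key : ∀ y : ℝ, 0 ≤ y → |y| < 1 →
      |∑ k ∈ Finset.range n, y ^ (2 * k + 1) / (2 * k + 1)| ≤
      |(Real.log (1 + y) - Real.log (1 - y)) / 2| := fun y hy0 hy => by
    have hnn : ∀ k : ℕ, 0 ≤ y ^ (2 * k + 1) / (2 * k + 1) := fun k => by positivity
    rw [abs_of_nonneg (Finset.sum_nonneg fun k _ => hnn k)]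
    exact (sum_le_hasSum _ (fun k _ => hnn k) (hasSum_artanh_series hy)).trans (le_abs_self _)
  rcases le_total 0 y with h | h
  · exact key y h hy
  · have h₁ := key (-y) (by linarith) (by rwa [abs_neg])
    have h₂ : ∑ k ∈ Finset.range n, (-y) ^ (2 * k + 1) / (2 * k + 1 : ℝ) =
        -∑ k ∈ Finset.range n, y ^ (2 * k + 1) / (2 * k + 1) := by
      rw [← Finset.sum_neg_distrib]
      exact Finset.sum_congr rfl fun k _ => by rw [Odd.neg_pow ⟨k, rfl⟩, neg_div]
    have h₃ : (Real.log (1 + -y) - Real.log (1 - -y)) / 2 =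
        -((Real.log (1 + y) - Real.log (1 - y)) / 2) := by
      rw [sub_neg_eq_add, ← sub_eq_add_neg]
      ring
    rwa [h₂, h₃, abs_neg, abs_neg] at h₁

theorem abs_cayley_lt_one {r : ℝ} (hr : 0 < r) : |(1 - r) / (1 + r)| < 1 := by
  rw [abs_div, div_lt_one (by positivity), abs_of_pos (by positivity : 0 < 1 + r), abs_lt]
  constructor <;> linarith

theorem neg_two_mul_artanh_cayley {r : ℝ} (hr : 0 < r) :
    -2 * ((Real.log (1 + (1 - r) / (1 + r)) - Real.log (1 - (1 - r) / (1 + r))) / 2) =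
      Real.log r := by
  have h₁ : 1 + (1 - r) / (1 + r) = 2 / (1 + r) := by field_simp; ring
  have h₂ : 1 - (1 - r) / (1 + r) = 2 * r / (1 + r) := by field_simp; ring
  rw [h₁, h₂, Real.log_div (by norm_num) (by positivity), Real.log_div (by positivity)
    (by positivity), Real.log_mul (by norm_num) hr.ne']
  ring

theorem Complex.arctan_mul_I {y : ℝ} (hy : |y| < 1) :
    Complex.arctan (y * Complex.I) =
      ((Real.log (1 + y) - Real.log (1 - y)) / 2 : ℝ) * Complex.I := by
  have h₁ := Complex.hasSum_arctan (z := y * Complex.I) (by simpa using hy)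
  have h₂ := (Complex.hasSum_ofReal.2 (hasSum_artanh_series hy)).mul_right Complex.I
  refine h₁.unique (h₂.congr_fun fun k => ?_)
  have : Complex.I ^ (2 * k + 1) = (-1) ^ k * Complex.I := by
    rw [pow_succ, pow_mul, Complex.I_sq]
  rw [mul_pow, this]
  have h3 : ((-1 : ℂ) ^ k) * (-1) ^ k = 1 := by rw [← mul_pow]; simp
  push_cast
  linear_combination ((y:ℂ) ^ (2 * k + 1) / (2 * k + 1) * Complex.I) * h3

theorem Complex.arctan_partialSum_mul_I (y : ℝ) (n : ℕ) :
    ∑ k ∈ Finset.range n, ((-1) ^ k / (2 * k + 1) : ℂ) * (y * Complex.I) ^ (2 * k + 1) =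
      (∑ k ∈ Finset.range n, y ^ (2 * k + 1) / (2 * k + 1) : ℝ) * Complex.I := by
  rw [Complex.ofReal_sum, Finset.sum_mul]
  refine Finset.sum_congr rfl fun k _ => ?_
  have : Complex.I ^ (2 * k + 1) = (-1) ^ k * Complex.I := by
    rw [pow_succ, pow_mul, Complex.I_sq]
  rw [mul_pow, this]
  have h3 : ((-1 : ℂ) ^ k) * (-1) ^ k = 1 := by rw [← mul_pow]; simp
  push_cast
  linear_combination ((y:ℂ) ^ (2 * k + 1) / (2 * k + 1) * Complex.I) * h3

theorem Complex.measurable_arctan : Measurable Complex.arctan := by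
  unfold Complex.arctan
  fun_prop

/-! ### Odd power series of a bounded operator -/

/-- The partial sum `∑_{k < n} cₖ D ^ (2 k + 1)`. -/
def oddPartialSum {𝕜 K : Type*} [RCLike 𝕜] [NormedAddCommGroup K] [InnerProductSpace 𝕜 K]
    (c : ℕ → 𝕜) (D : K →L[𝕜] K) (n : ℕ) : K →L[𝕜] K :=
  ∑ k ∈ Finset.range n, c k • D ^ (2 * k + 1)

theorem oddPartialSum_apply {𝕜 K : Type*} [RCLike 𝕜] [NormedAddCommGroup K]
    [InnerProductSpace 𝕜 K] (c : ℕ → 𝕜) (D : K →L[𝕜] K) (n : ℕ) (x : K) :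
    oddPartialSum c D n x = ∑ k ∈ Finset.range n, c k • (D ^ (2 * k + 1)) x := by
  simp [oddPartialSum]

namespace ProjectionValuedMeasure

section Powers

variable {𝕜 K α : Type*} [RCLike 𝕜] [NormedAddCommGroup K] [InnerProductSpace 𝕜 K]
  [CompleteSpace K] [MeasurableSpace α] {P : ProjectionValuedMeasure 𝕜 K α} {D : K →L[𝕜] K}
  {v : α → 𝕜}

theorem pow_mem_integral (hv : Measurable v) (h : ∀ w, (w, D w) ∈ P.integral v) (k : ℕ) (x : K) :
    (x, (D ^ k) x) ∈ P.integral (v ^ k) := by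
  induction k with
  | zero => simpa using P.integral_one x
  | succ k ih =>
    rw [pow_succ', pow_succ', mul_apply_eq_comp]
    exact (mem_integral_iff_mul_mem (hv.pow_const k) hv ih).1 (h _)

theorem oddPartialSum_mem_integral (hv : Measurable v) (h : ∀ w, (w, D w) ∈ P.integral v)
    (c : ℕ → 𝕜) (n : ℕ) (x : K) : (x, oddPartialSum c D n x) ∈
      P.integral (fun z => ∑ k ∈ Finset.range n, c k * v z ^ (2 * k + 1)) := by
  rw [oddPartialSum_apply]
  induction n with
  | zero => simpa [Pi.zero_def] using integral_smul (0 : 𝕜) (P.integral_one x)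
  | succ n ih =>
    simp only [Finset.sum_range_succ]
    exact integral_add (by fun_prop) (by fun_prop) ih
      (integral_smul (c n) (pow_mem_integral hv h (2 * n + 1) x))

end Powers

/-- If `D` is the Cayley transform `(1 - A) / (1 + A)` of the positive operator `A = ∫ r dP(r)`,
then `log A` is the sum of the power series of `-2 artanh D`, and its domain is the set of
convergence. -/
theorem mem_integral_log_iff {H : Type*} [NormedAddCommGroup H] [InnerProductSpace ℝ H]
    [CompleteSpace H] {P : ProjectionValuedMeasure ℝ H ℝ} {D : H →L[ℝ] H} {x y : H}
    (hpos : ∀ᵐ r ∂(P.measure x), 0 < r)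
    (hD : ∀ w, (w, D w) ∈ P.integral (fun r => (1 - r) / (1 + r))) :
    (x, y) ∈ P.integral Real.log ↔
      Tendsto (fun n => oddPartialSum (fun k => (-2 / (2 * k + 1) : ℝ)) D n x) atTop (𝓝 y) := by
  have hv : Measurable fun r : ℝ => (1 - r) / (1 + r) := by fun_prop
  have hsum : ∀ (t : ℝ) n, ∑ k ∈ Finset.range n, (-2 / (2 * k + 1) : ℝ) * t ^ (2 * k + 1) =
      -2 * ∑ k ∈ Finset.range n, t ^ (2 * k + 1) / (2 * k + 1) := fun t n => by
    rw [Finset.mul_sum]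
    exact Finset.sum_congr rfl fun k _ => by ring
  refine mem_integral_iff_tendsto Real.measurable_log (fun n => ?_)
    (fun n => oddPartialSum_mem_integral hv hD _ n x) ?_ ?_
  · fun_prop
  · filter_upwards [hpos] with r hr n
    rw [hsum, ← neg_two_mul_artanh_cayley hr, norm_mul, norm_mul]
    exact mul_le_mul_of_nonneg_left (abs_artanh_partialSum_le (abs_cayley_lt_one hr) n)
      (norm_nonneg _)
  · filter_upwards [hpos] with r hr
    simp only [hsum]
    rw [← neg_two_mul_artanh_cayley hr]
    exact (hasSum_artanh_series (abs_cayley_lt_one hr)).tendsto_sum_nat.const_mul (-2)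

end ProjectionValuedMeasure

/-! ### The arctangent of a bounded skew-adjoint operator -/

section Arctan

open ProjectionValuedMeasure

variable {K : Type*} [NormedAddCommGroup K] [InnerProductSpace ℂ K] [CompleteSpace K]
  {A : K →L[ℂ] K}

/-- The spectral measure of a skew-adjoint `A` is the push-forward of that of the selfadjoint
`-i A` along `t ↦ i t`. -/
theorem exists_isSpectralMeasure_of_skewAdjoint (hA : ContinuousLinearMap.adjoint A = -A) :
    ∃ P : ProjectionValuedMeasure ℂ K ℂ, IsSpectralMeasure P (graphOfCLM A) := by
  have hM : IsSelfAdjoint (-Complex.I • A) := by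
    rw [IsSelfAdjoint, star_smul, ContinuousLinearMap.star_eq_adjoint, hA]
    simp
  obtain ⟨R, μ, h⟩ := exists_isScalarSpectralFamily_complex hM
  have hφ : Measurable fun t : ℝ => Complex.I * t := by fun_prop
  refine ⟨(h.pvm hM).map _ hφ, ?_⟩
  have key : ∀ x, (x, A x) ∈ ((h.pvm hM).map _ hφ).integral fun z => z := fun x => by
    rw [integral_map hφ measurable_id']
    have := integral_smul Complex.I (h.mem_integral_id_pvm hM x)
    rw [smul_apply, smul_smul] at this
    simpa using! this
  ext ⟨x, y⟩
  refine ⟨fun hy => integral_unique measurable_id' hy (key x), ?_⟩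
  intro hy
  have hy' : y = A x := hy
  rw [hy']
  exact key x

/-- The spectral measure of a skew-adjoint strict contraction is carried by the segment
`{i t | |t| < 1}`. -/
theorem ae_eq_mul_I_of_isSpectralMeasure (hA : ContinuousLinearMap.adjoint A = -A)
    (hlt : ∀ x, x ≠ 0 → ‖A x‖ < ‖x‖) {P : ProjectionValuedMeasure ℂ K ℂ}
    (hP : IsSpectralMeasure P (graphOfCLM A)) (x : K) :
    ∀ᵐ z ∂(P.measure x), |z.im| < 1 ∧ z = z.im * Complex.I := by
  have hgraph : ∀ x y, (x, y) ∈ P.integral (fun z => z) → y = A x := fun x y hy => by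
    rw [hP] at hy
    exact hy
  have hre : ∀ x, RCLike.re (inner ℂ (A x) x) = 0 := fun x => by
    have h := ContinuousLinearMap.adjoint_inner_left A x x
    rw [hA, neg_apply, inner_neg_left] at h
    have h' := congrArg RCLike.re h
    rw [map_neg, inner_re_symm (𝕜 := ℂ) x] at h'
    linarith
  have h₁ := ae_norm_lt_of_forall_norm_lt (P := P) measurable_id' 0 1 1 0 (fun x y hy hx => by
    rw [hgraph x y hy]
    simpa using hlt x hx) x
  -- the real part of `⟪A x, x⟫` vanishes, hence `A x` is closer to `0` than to `ε x`
  have h₂ : ∀ ε : ℝ, ε ≠ 0 → ∀ᵐ z ∂(P.measure x), ‖z‖ < ‖-(ε : ℂ) + z‖ := fun ε hε => by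
    have := ae_norm_lt_of_forall_norm_lt (P := P) measurable_id' 0 1 (-(ε : ℂ)) 1
      (fun x y hy hx => by
        rw [hgraph x y hy]
        have h3 : 0 < ‖x‖ := norm_pos_iff.2 hx
        refine lt_of_pow_lt_pow_left₀ 2 (norm_nonneg _) ?_
        rw [zero_smul, zero_add, one_smul, neg_smul, neg_add_eq_sub, @norm_sub_sq ℂ,
          inner_smul_right]
        have h4 : RCLike.re ((ε : ℂ) * inner ℂ (A x) x) = 0 := by
          have := hre x
          simp only [RCLike.re_to_complex] at this
          simp [this]
        rw [h4, norm_smul]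
        have : 0 < ‖(ε : ℂ)‖ := by simpa using hε
        have : 0 < (‖(ε : ℂ)‖ * ‖x‖) ^ 2 := by positivity
        linarith) x
    simpa using this
  have h₃ : ∀ᵐ z ∂(P.measure x), ∀ n : ℕ, ‖z‖ < ‖-((1 / (n + 1) : ℝ) : ℂ) + z‖ ∧
      ‖z‖ < ‖-((-(1 / (n + 1)) : ℝ) : ℂ) + z‖ := by
    rw [ae_all_iff]
    intro n
    have : (1 / (n + 1) : ℝ) ≠ 0 := by positivity
    exact (h₂ _ this).and (h₂ _ (neg_ne_zero.2 this))
  filter_upwards [h₁, h₃] with z hz₁ hz₃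
  have hz₁' : ‖z‖ < 1 := by simpa using hz₁
  have hlim : Tendsto (fun n : ℕ => (1 / (n + 1) : ℝ)) atTop (𝓝 0) :=
    tendsto_one_div_add_atTop_nhds_zero_nat
  have key : ∀ ε : ℝ, ‖z‖ < ‖-(ε : ℂ) + z‖ → 2 * ε * z.re ≤ ε ^ 2 := fun ε h => by
    have h5 := pow_lt_pow_left₀ h (norm_nonneg _) two_ne_zero
    rw [← Complex.normSq_eq_norm_sq, ← Complex.normSq_eq_norm_sq, Complex.normSq_apply,
      Complex.normSq_apply] at h5
    simp at h5
    nlinarith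
  have hle : z.re ≤ 0 := by
    refine ge_of_tendsto' (x := atTop) (f := fun n : ℕ => (1 / (n + 1) : ℝ)) hlim fun n => ?_
    have h6 := key _ (hz₃ n).1
    have : (0 : ℝ) < 1 / (n + 1) := by positivity
    nlinarith
  have hge : -z.re ≤ 0 := by
    refine ge_of_tendsto' (x := atTop) (f := fun n : ℕ => (1 / (n + 1) : ℝ)) hlim fun n => ?_
    have h6 := key _ (hz₃ n).2
    have : (0 : ℝ) < 1 / (n + 1) := by positivity
    nlinarith
  refine ⟨(Complex.abs_im_le_norm z).trans_lt hz₁', Complex.ext ?_ ?_⟩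
  · simp
    linarith
  · simp

/-- The arctangent of a skew-adjoint strict contraction is the sum of its power series, and its
domain is the set of convergence. -/
theorem mem_borelCalculus_arctan_iff (hA : ContinuousLinearMap.adjoint A = -A)
    (hlt : ∀ x, x ≠ 0 → ‖A x‖ < ‖x‖) {x y : K} :
    (x, y) ∈ borelCalculus Complex.arctan (graphOfCLM A) ↔
      Tendsto (fun n => oddPartialSum (fun k => ((-1) ^ k / (2 * k + 1) : ℂ)) A n x) atTop
        (𝓝 y) := by
  have key : ∀ P : ProjectionValuedMeasure ℂ K ℂ, IsSpectralMeasure P (graphOfCLM A) →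
      ((x, y) ∈ P.integral Complex.arctan ↔
        Tendsto (fun n => oddPartialSum (fun k => ((-1) ^ k / (2 * k + 1) : ℂ)) A n x) atTop
          (𝓝 y)) := fun P hP => by
    have hD : ∀ w, (w, A w) ∈ P.integral fun z => z := fun w => by
      rw [hP]
      rfl
    refine mem_integral_iff_tendsto Complex.measurable_arctan (fun n => by fun_prop)
      (fun n => oddPartialSum_mem_integral measurable_id' hD _ n x) ?_ ?_
    · filter_upwards [ae_eq_mul_I_of_isSpectralMeasure hA hlt hP x] with z hz n
      rw [hz.2, Complex.arctan_partialSum_mul_I, Complex.arctan_mul_I hz.1, norm_mul, norm_mul,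
        Complex.norm_real, Complex.norm_real]
      exact mul_le_mul_of_nonneg_right (abs_artanh_partialSum_le hz.1 n) (norm_nonneg _)
    · filter_upwards [ae_eq_mul_I_of_isSpectralMeasure hA hlt hP x] with z hz
      rw [hz.2]
      simp only [Complex.arctan_partialSum_mul_I]
      rw [Complex.arctan_mul_I hz.1]
      exact ((Complex.continuous_ofReal.tendsto _).comp
        (hasSum_artanh_series hz.1).tendsto_sum_nat).mul_const Complex.I
  constructor
  · rintro ⟨P, hP, h⟩
    exact (key P hP).1 h
  · intro h
    obtain ⟨P, hP⟩ := exists_isSpectralMeasure_of_skewAdjoint hA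
    exact ⟨P, hP, (key P hP).2 h⟩

end Arctan

/-! ### The modular operator of a standard subspace -/

section Modular

variable {H : Type*} [NormedAddCommGroup H] [InnerProductSpace ℝ H]

/-- The operator `(E + E') / 2`, where `E' = -I E I`. If `E` is the projector onto `L`, then `E'`
is the projector onto `I L`, and the operator is `(1 + Δ)⁻¹`. -/
def modularResolvent (I E : H →L[ℝ] H) : H →L[ℝ] H := (1 / 2 : ℝ) • (E - I * E * I)

/-- The Cayley transform `(1 - Δ) / (1 + Δ)` of the modular operator. -/
def modularCayley (I E : H →L[ℝ] H) : H →L[ℝ] H := E - I * E * I - 1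

theorem modularResolvent_apply (I E : H →L[ℝ] H) (x : H) :
    modularResolvent I E x = (1 / 2 : ℝ) • (E x - I (E (I x))) := rfl

theorem modularCayley_apply (I E : H →L[ℝ] H) (x : H) :
    modularCayley I E x = E x - I (E (I x)) - x := rfl

variable [CompleteSpace H] {I : H →L[ℝ] H} {L : ClosedSubmodule ℝ H} {E : H →L[ℝ] H}

namespace IsComplexStructure

theorem apply_apply (hI : IsComplexStructure I) (x : H) : I (I x) = -x :=
  congrArg (fun A : H →L[ℝ] H => A x) hI.sq_eq

theorem inner_left (hI : IsComplexStructure I) (x y : H) : inner ℝ (I x) y = -inner ℝ x (I y) := by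
  rw [← ContinuousLinearMap.adjoint_inner_right, hI.adjoint_eq, neg_apply, inner_neg_right]

theorem norm_apply (hI : IsComplexStructure I) (x : H) : ‖I x‖ = ‖x‖ := by
  rw [← sq_eq_sq₀ (norm_nonneg _) (norm_nonneg _), ← real_inner_self_eq_norm_sq, hI.inner_left,
    hI.apply_apply, inner_neg_right, neg_neg, real_inner_self_eq_norm_sq]

end IsComplexStructure

namespace IsStandard

theorem eq_zero (hL : IsStandard I L) (hI : IsComplexStructure I) {x : H} (h₁ : x ∈ L)
    (h₂ : I x ∈ L) : x = 0 := by
  have h : x ∈ L.toSubmodule ⊓ L.toSubmodule.map I.toLinearMap :=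
    ⟨h₁, -I x, L.toSubmodule.neg_mem h₂, by simp [hI.apply_apply]⟩
  rw [hL.separating] at h
  exact h

end IsStandard

section Projection

theorem starProjection_mem_of_eq (hE : E = L.toSubmodule.starProjection) (x : H) : E x ∈ L := by
  rw [hE]
  exact L.toSubmodule.starProjection_apply_mem x

theorem starProjection_eq_self_iff_of_eq (hE : E = L.toSubmodule.starProjection) {x : H} :
    E x = x ↔ x ∈ L := by
  rw [hE]
  exact Submodule.starProjection_eq_self_iff

theorem starProjection_idem_of_eq (hE : E = L.toSubmodule.starProjection) (x : H) :
    E (E x) = E x :=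
  (starProjection_eq_self_iff_of_eq hE).2 (starProjection_mem_of_eq hE x)

theorem inner_starProjection_of_eq (hE : E = L.toSubmodule.starProjection) (x y : H) :
    inner ℝ (E x) y = inner ℝ x (E y) := by
  rw [hE]
  exact Submodule.inner_starProjection_left_eq_right _ _ _

theorem starProjection_eq_zero_iff_of_eq (hE : E = L.toSubmodule.starProjection) {x : H} :
    E x = 0 ↔ ∀ h ∈ L, inner ℝ h x = 0 := by
  rw [hE, Submodule.starProjection_apply_eq_zero_iff]
  exact Submodule.mem_orthogonal _ _

end Projection

theorem mem_preTomitaGraph_iff (hI : IsComplexStructure I) {p : H × H} :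
    p ∈ preTomitaGraph I L ↔ p.1 + p.2 ∈ L ∧ I (p.1 - p.2) ∈ L := by
  constructor
  · rintro ⟨h, hh, k, hk, rfl⟩
    have h₁ : h + I k + (h - I k) = (2 : ℝ) • h := by module
    have h₂ : I (h + I k - (h - I k)) = (-2 : ℝ) • k := by
      rw [show h + I k - (h - I k) = (2 : ℝ) • I k by module, map_smul, hI.apply_apply]
      module
    rw [h₁, h₂]
    exact ⟨L.toSubmodule.smul_mem _ hh, L.toSubmodule.smul_mem _ hk⟩
  · rintro ⟨h₁, h₂⟩
    refine ⟨(1 / 2 : ℝ) • (p.1 + p.2), L.toSubmodule.smul_mem _ h₁,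
      (-1 / 2 : ℝ) • I (p.1 - p.2), L.toSubmodule.smul_mem _ h₂, ?_⟩
    rw [map_smul, hI.apply_apply]
    ext
    · simp only
      module
    · simp only
      module

/-- The map `h + I k ↦ h - I k` is already closed, so that its graph is that of the Tomita
operator. -/
theorem graph_tomitaOperator (hI : IsComplexStructure I) (hL : IsStandard I L) :
    (tomitaOperator I L).graph = preTomitaGraph I L := by
  have hg : (preTomitaGraph I L).toLinearPMap.graph = preTomitaGraph I L := by
    refine Submodule.toLinearPMap_graph_eq _ fun p hp hp1 => ?_
    rw [mem_preTomitaGraph_iff hI, hp1, zero_add, zero_sub, map_neg] at hp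
    exact hL.eq_zero hI hp.1 (by simpa using L.toSubmodule.neg_mem hp.2)
  have hc : (preTomitaGraph I L).toLinearPMap.IsClosed := by
    rw [LinearPMap.IsClosed, hg]
    have : (preTomitaGraph I L : Set (H × H)) =
        (fun p => p.1 + p.2) ⁻¹' L ∩ (fun p => I (p.1 - p.2)) ⁻¹' L := by
      ext p
      exact mem_preTomitaGraph_iff hI
    rw [this]
    exact (L.isClosed.preimage (by fun_prop)).inter (L.isClosed.preimage (by fun_prop))
  rw [tomitaOperator, ← hc.isClosable.graph_closure_eq_closure_graph,
    hc.submodule_topologicalClosure_eq, hg]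

theorem dense_domain_tomitaOperator (hI : IsComplexStructure I) (hL : IsStandard I L) :
    Dense ((tomitaOperator I L).domain : Set H) := by
  have h := Submodule.dense_iff_topologicalClosure_eq_top.2 hL.cyclic
  refine h.mono fun x hx => ?_
  obtain ⟨h, hh, _, ⟨k, hk, rfl⟩, rfl⟩ := Submodule.mem_sup.1 hx
  have : (h + I k, h - I k) ∈ (tomitaOperator I L).graph := by
    rw [graph_tomitaOperator hI hL]
    exact ⟨h, hh, k, hk, rfl⟩
  exact LinearPMap.mem_domain_of_mem_graph this

/-- Since `E I v = 0` says that `v` is orthogonal to `I L`, this describes the graph of `T†` by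
testing against `h` and `I k` with `h, k ∈ L` separately. -/
theorem mem_graph_adjoint_tomitaOperator_iff (hI : IsComplexStructure I) (hL : IsStandard I L)
    (hE : E = L.toSubmodule.starProjection) {y z : H} :
    (y, z) ∈ (tomitaOperator I L).adjoint.graph ↔ E (z - y) = 0 ∧ E (I (z + y)) = 0 := by
  rw [LinearPMap.adjoint_graph_eq_graph_adjoint (dense_domain_tomitaOperator hI hL),
    Submodule.mem_adjoint_iff, graph_tomitaOperator hI hL, starProjection_eq_zero_iff_of_eq hE,
    starProjection_eq_zero_iff_of_eq hE]
  constructor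
  · refine fun h => ⟨fun u hu => ?_, fun u hu => ?_⟩
    · have := h u u ⟨u, hu, 0, zero_mem L, by simp⟩
      rw [inner_sub_right]
      linarith
    · have := h (I u) (-I u) ⟨0, zero_mem L, u, hu, by simp⟩
      rw [inner_neg_left, hI.inner_left, hI.inner_left] at this
      rw [map_add, inner_add_right]
      linarith
  · rintro ⟨h₁, h₂⟩ a b ⟨u, hu, v, hv, huv⟩
    obtain ⟨rfl, rfl⟩ := Prod.mk.inj huv
    have h₃ := h₁ u hu
    have h₄ := h₂ v hv
    rw [inner_sub_right] at h₃
    rw [map_add, inner_add_right] at h₄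
    simp only [inner_sub_left, inner_add_left, hI.inner_left]
    linarith

/-- The modular operator is `(1 - S) S⁻¹`, where `S = (E + E') / 2`. -/
theorem mem_modularOperator_iff (hI : IsComplexStructure I) (hL : IsStandard I L)
    (hE : E = L.toSubmodule.starProjection) {x z : H} :
    (x, z) ∈ modularOperator I L ↔
      ∃ w, x = modularResolvent I E w ∧ z = w - modularResolvent I E w := by
  change (∃ y, (x, y) ∈ (tomitaOperator I L).graph ∧ (y, z) ∈ (tomitaOperator I L).adjoint.graph)
    ↔ _
  simp only [mem_graph_adjoint_tomitaOperator_iff hI hL hE, graph_tomitaOperator hI hL,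
    mem_preTomitaGraph_iff hI, ← starProjection_eq_self_iff_of_eq hE, modularResolvent_apply]
  constructor
  · rintro ⟨y, ⟨h₁, h₂⟩, h₃, h₄⟩
    have h₅ : E (x + z) = x + y := by
      rw [show x + z = (x + y) + (z - y) by abel, map_add, h₁, h₃, add_zero]
    have h₆ : E (I (x + z)) = I (x - y) := by
      rw [show x + z = (x - y) + (z + y) by abel, map_add, map_add, h₂, h₄, add_zero]
    have h₇ : (1 / 2 : ℝ) • (E (x + z) - I (E (I (x + z)))) = x := by
      rw [h₅, h₆, hI.apply_apply]
      module
    exact ⟨x + z, h₇.symm, by rw [h₇]; abel⟩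
  · rintro ⟨w, rfl, rfl⟩
    have h₁ := starProjection_idem_of_eq hE w
    have h₂ := starProjection_idem_of_eq hE (I w)
    refine ⟨(1 / 2 : ℝ) • (E w + I (E (I w))), ⟨?_, ?_⟩, ?_, ?_⟩
    · rw [show (1 / 2 : ℝ) • (E w - I (E (I w))) + (1 / 2 : ℝ) • (E w + I (E (I w))) = E w by
        module, h₁]
    · rw [show (1 / 2 : ℝ) • (E w - I (E (I w))) - (1 / 2 : ℝ) • (E w + I (E (I w))) =
        -I (E (I w)) by module, map_neg, hI.apply_apply, neg_neg, h₂]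
    · rw [show w - (1 / 2 : ℝ) • (E w - I (E (I w))) - (1 / 2 : ℝ) • (E w + I (E (I w))) =
        w - E w by module, map_sub, h₁, sub_self]
    · rw [show w - (1 / 2 : ℝ) • (E w - I (E (I w))) + (1 / 2 : ℝ) • (E w + I (E (I w))) =
        w + I (E (I w)) by module, map_add, map_add, hI.apply_apply, map_neg, h₂, add_neg_cancel]

/-- Strict positivity of the modular operator: `⟪x, Δ x⟫ = ‖T x‖² > 0`. -/
theorem inner_pos_of_mem_modularOperator (hI : IsComplexStructure I) (hL : IsStandard I L)
    {x z : H} (h : (x, z) ∈ modularOperator I L) (hx : x ≠ 0) : 0 < inner ℝ x z := by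
  obtain ⟨y, hy, hz⟩ := h
  have hxy := hy
  rw [graph_tomitaOperator hI hL] at hxy
  rw [LinearPMap.adjoint_graph_eq_graph_adjoint (dense_domain_tomitaOperator hI hL),
    Submodule.mem_adjoint_iff] at hz
  have h₁ := hz x y hy
  simp only at h₁
  rw [← sub_eq_zero.1 h₁, real_inner_self_eq_norm_sq]
  have : y ≠ 0 := by
    rintro rfl
    rw [mem_preTomitaGraph_iff hI] at hxy
    simp only [add_zero, sub_zero] at hxy
    exact hx (hL.eq_zero hI hxy.1 hxy.2)
  positivity

theorem isSelfAdjoint_modularResolvent (hI : IsComplexStructure I)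
    (hE : E = L.toSubmodule.starProjection) : IsSelfAdjoint (modularResolvent I E) := by
  rw [ContinuousLinearMap.isSelfAdjoint_iff_isSymmetric]
  intro x y
  simp only [ContinuousLinearMap.coe_coe, modularResolvent_apply]
  rw [inner_smul_left, inner_smul_right, inner_sub_left, inner_sub_right, hI.inner_left,
    inner_starProjection_of_eq hE, inner_starProjection_of_eq hE, hI.inner_left]
  simp

/-- The operator `(E + E') / 2` is injective: a vector in its kernel is orthogonal to `L` and
to `I L`. -/
theorem modularResolvent_ne_zero (hI : IsComplexStructure I) (hL : IsStandard I L)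
    (hE : E = L.toSubmodule.starProjection) {x : H} (hx : x ≠ 0) : modularResolvent I E x ≠ 0 := by
  intro h
  rw [modularResolvent_apply, smul_eq_zero, or_iff_right (by norm_num), sub_eq_zero] at h
  have h₁ : E x = 0 := by
    refine hL.eq_zero hI (starProjection_mem_of_eq hE x) ?_
    rw [h, hI.apply_apply]
    exact L.toSubmodule.neg_mem (starProjection_mem_of_eq hE _)
  have h₂ : E (I x) = 0 := by
    have : I (I (E (I x))) = 0 := by rw [← h, h₁, map_zero]
    rwa [hI.apply_apply, neg_eq_zero] at this
  rw [starProjection_eq_zero_iff_of_eq hE] at h₁ h₂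
  refine hx ((Submodule.dense_iff_topologicalClosure_eq_top.2 hL.cyclic).eq_zero_of_inner_right ℝ
    fun v hv => ?_)
  obtain ⟨h, hh, _, ⟨k, hk, rfl⟩, rfl⟩ := Submodule.mem_sup.1 hv
  have h₃ := h₂ k hk
  rw [← neg_eq_zero, ← hI.inner_left] at h₃
  rw [inner_add_left, h₁ h hh]
  simpa using h₃

open ProjectionValuedMeasure

/-- The spectral measure of the modular operator `(1 - S) S⁻¹` is the push-forward of that of the
bounded operator `S` along `s ↦ (1 - s) / s`. -/
theorem exists_isSpectralMeasure_modularOperator (hI : IsComplexStructure I) (hL : IsStandard I L) :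
    ∃ P : ProjectionValuedMeasure ℝ H ℝ, IsSpectralMeasure P (modularOperator I L) := by
  obtain ⟨E, hE⟩ : ∃ E, E = L.toSubmodule.starProjection := ⟨_, rfl⟩
  set S := modularResolvent I E with hS
  have hSA := isSelfAdjoint_modularResolvent hI hE
  obtain ⟨R, μ, h⟩ := exists_isScalarSpectralFamily_real hSA
  have hφ : Measurable fun s : ℝ => (1 - s) / s := by fun_prop
  have hid : ∀ w, (w, S w) ∈ (h.pvm hSA).integral fun s => s := h.mem_integral_id_pvm hSA
  -- `0` is not in the point spectrum of `S`
  have hne : ∀ x, ∀ᵐ s ∂((h.pvm hSA).measure x), s ≠ 0 := fun x => by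
    have := ae_norm_lt_of_forall_norm_lt (P := h.pvm hSA) measurable_id' 0 0 0 1
      (fun x y hy hx => by
        rw [integral_unique measurable_id' hy (hid x)]
        simpa using modularResolvent_ne_zero hI hL hE hx) x
    filter_upwards [this] with s hs
    simpa using hs
  refine ⟨(h.pvm hSA).map _ hφ, ?_⟩
  rw [IsSpectralMeasure, integral_map hφ measurable_id']
  change (h.pvm hSA).integral (fun s => (1 - s) / s) = _
  ext ⟨x, y⟩
  rw [mem_modularOperator_iff hI hL hE]
  constructor
  · intro hxy
    have h₁ : (x, x + y) ∈ (h.pvm hSA).integral fun s => s⁻¹ := by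
      refine integral_congr_ae (integral_add measurable_one hφ (integral_one _ x) hxy) ?_
      filter_upwards [hne x] with s hs
      simp only [Pi.add_apply, Pi.one_apply]
      field_simp
      ring
    have h₂ := (mem_integral_iff_mul_mem measurable_inv measurable_id' h₁).1 (hid (x + y))
    have h₃ : S (x + y) = x := by
      refine integral_unique measurable_one (integral_congr_ae h₂ ?_) (integral_one _ x)
      filter_upwards [hne x] with s hs
      simp [hs]
    exact ⟨x + y, h₃.symm, by rw [← hS, h₃]; abel⟩
  · rintro ⟨w, rfl, rfl⟩
    rw [mem_integral_iff_mul_mem measurable_id' hφ (hid w)]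
    refine integral_congr_ae (integral_sub measurable_one measurable_id' (integral_one _ w)
      (hid w)) ?_
    filter_upwards [hne w] with s hs
    simp [hs]

/-- The logarithm of the modular operator is the sum of the power series of `-2 artanh D`, where
`D` is its Cayley transform. -/
theorem mem_logModularOperator_iff (hI : IsComplexStructure I) (hL : IsStandard I L)
    (hE : E = L.toSubmodule.starProjection) {x y : H} :
    (x, y) ∈ logModularOperator I L ↔ Tendsto (fun n =>
      oddPartialSum (fun k => (-2 / (2 * k + 1) : ℝ)) (modularCayley I E) n x) atTop (𝓝 y) := by
  have key : ∀ P : ProjectionValuedMeasure ℝ H ℝ, IsSpectralMeasure P (modularOperator I L) →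
      ((x, y) ∈ P.integral Real.log ↔ Tendsto (fun n =>
        oddPartialSum (fun k => (-2 / (2 * k + 1) : ℝ)) (modularCayley I E) n x) atTop (𝓝 y)) := by
    intro P hP
    have hpos : ∀ x, ∀ᵐ r ∂(P.measure x), 0 < r := fun x => by
      have := ae_norm_lt_of_forall_norm_lt (P := P) measurable_id' 1 (-1) 1 1
        (fun x y hy hx => by
          rw [hP] at hy
          have h₁ := inner_pos_of_mem_modularOperator hI hL hy hx
          refine lt_of_pow_lt_pow_left₀ 2 (norm_nonneg _) ?_
          rw [one_smul, one_smul, neg_one_smul, ← sub_eq_add_neg, norm_sub_sq_real,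
            norm_add_sq_real]
          linarith) x
      filter_upwards [this] with r hr
      have h₂ := sq_lt_sq.2 hr
      nlinarith
    refine mem_integral_log_iff (hpos x) fun w => ?_
    set S := modularResolvent I E with hS
    have h₁ : (S w, w - S w) ∈ P.integral fun r => r := by
      rw [hP, mem_modularOperator_iff hI hL hE]
      exact ⟨w, rfl, rfl⟩
    have h₂ := integral_add measurable_one measurable_id' (integral_one P (S w)) h₁
    have h₃ := integral_sub measurable_one measurable_id' (integral_one P (S w)) h₁
    rw [add_sub_cancel] at h₂
    have h₄ : S w - (w - S w) = modularCayley I E w := by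
      rw [hS, modularResolvent_apply, modularCayley_apply]
      module
    rw [h₄] at h₃
    rw [mem_integral_iff_mul_mem (measurable_one.add measurable_id') (by fun_prop) h₂]
    refine integral_congr_ae h₃ ?_
    filter_upwards [hpos (S w)] with r hr
    have : 1 + r ≠ 0 := by positivity
    simp [this]
  constructor
  · rintro ⟨P, hP, h⟩
    exact (key P hP).1 h
  · intro h
    obtain ⟨P, hP⟩ := exists_isSpectralMeasure_modularOperator hI hL
    exact ⟨P, hP, (key P hP).2 h⟩

/-! ### The compression `E I E` -/

/-- Equality would force `x` and `I x` into `L`, against the separating property. -/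
theorem norm_compression_lt (hI : IsComplexStructure I) (hL : IsStandard I L)
    (hE : E = L.toSubmodule.starProjection) {x : H} (hx : x ≠ 0) : ‖(E * I * E) x‖ < ‖x‖ := by
  have hle : ∀ v, ‖E v‖ ≤ ‖v‖ := fun v => by
    rw [hE]
    exact Submodule.norm_starProjection_apply_le _ v
  have hmem : ∀ v, ‖v‖ ≤ ‖E v‖ → v ∈ L := fun v hv => by
    refine (Submodule.mem_iff_norm_starProjection L.toSubmodule v).2 ?_
    rw [← hE]
    exact le_antisymm (hle v) hv
  change ‖E (I (E x))‖ < ‖x‖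
  by_contra! h
  have h₁ : x ∈ L := hmem x (by
    rw [← hI.norm_apply (E x)]
    exact h.trans (hle _))
  rw [(starProjection_eq_self_iff_of_eq hE).2 h₁] at h
  exact hx (hL.eq_zero hI h₁ (hmem _ (by rwa [hI.norm_apply])))

theorem adjoint_compression (hI : IsComplexStructure I) (hE : E = L.toSubmodule.starProjection) :
    ContinuousLinearMap.adjoint (E * I * E) = -(E * I * E) := by
  symm
  rw [ContinuousLinearMap.eq_adjoint_iff]
  intro x y
  change inner ℝ (-E (I (E x))) y = inner ℝ x (E (I (E y)))
  rw [inner_neg_left, inner_starProjection_of_eq hE, hI.inner_left, inner_starProjection_of_eq hE,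
    neg_neg]

/-- The compression `E I E` is the restriction of `I D` to `L`, where `D` is the Cayley transform
of the modular operator; `I` and `D` commute, so its odd powers reduce to those of `D`. -/
theorem compression_pow (hI : IsComplexStructure I) (hE : E = L.toSubmodule.starProjection)
    (k : ℕ) : (E * I * E) ^ (2 * k + 1) =
      (-1 : ℝ) ^ k • (I * modularCayley I E ^ (2 * k + 1) * E) := by
  have hII : I * I = -1 := hI.sq_eq
  have hEE : E * E = E := ContinuousLinearMap.ext fun x => starProjection_idem_of_eq hE x
  set D := modularCayley I E with hD
  have h₁ : I * D = I * E + E * I - I := by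
    rw [hD, modularCayley, mul_sub, mul_sub, ← mul_assoc, ← mul_assoc, hII]
    noncomm_ring
  have h₂ : D * I = I * D := by
    rw [h₁, hD, modularCayley, sub_mul, sub_mul, mul_assoc (I * E), hII]
    noncomm_ring
  have h₃ : I * D * E = E * I * E := by
    rw [h₁, sub_mul, add_mul, mul_assoc I E E, hEE]
    abel
  have h₄ : E * (I * D) = E * I * E := by
    rw [h₁, mul_sub, mul_add, ← mul_assoc E E I, hEE, ← mul_assoc]
    abel
  have h₅ : ∀ n : ℕ, (E * I * E) ^ (n + 1) = (I * D) ^ (n + 1) * E := fun n => by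
    induction n with
    | zero => rw [zero_add, pow_one, pow_one, h₃]
    | succ n ih =>
      rw [pow_succ, ih, ← h₄, mul_assoc, ← mul_assoc E E, hEE, h₄, ← h₃, ← mul_assoc, ← pow_succ]
  have h₆ : I ^ (2 * k + 1) = (-1 : ℝ) ^ k • I := by
    rw [pow_succ, pow_mul, pow_two, hII]
    rcases Nat.even_or_odd k with hk | hk <;> simp [hk.neg_one_pow]
  rw [h₅, (show Commute I D from h₂.symm).mul_pow, h₆, smul_mul_assoc, smul_mul_assoc]

/-- The compressed generator `E (I ln Δ) E` is the sum of the power series of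
`-2 arctan (E I E)`, and its domain is the set of convergence. -/
theorem mem_restrictedModularGenerator_iff (hI : IsComplexStructure I) (hL : IsStandard I L)
    (hE : E = L.toSubmodule.starProjection) {x z : H} :
    (x, z) ∈ restrictedModularGenerator I L ↔ Tendsto (fun n => (-2 : ℝ) •
      oddPartialSum (fun k => ((-1) ^ k / (2 * k + 1) : ℝ)) (E * I * E) n x) atTop (𝓝 z) := by
  change (∃ y, (L.toSubmodule.starProjection x, y) ∈ logModularOperator I L ∧
    z = L.toSubmodule.starProjection (I y)) ↔ _
  rw [← hE]
  simp only [mem_logModularOperator_iff hI hL hE]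
  have h₁ : ∀ n, (-2 : ℝ) • oddPartialSum (fun k => ((-1) ^ k / (2 * k + 1) : ℝ)) (E * I * E) n x =
      I (oddPartialSum (fun k => (-2 / (2 * k + 1) : ℝ)) (modularCayley I E) n (E x)) := fun n => by
    rw [oddPartialSum_apply, oddPartialSum_apply, map_sum, Finset.smul_sum]
    refine Finset.sum_congr rfl fun k _ => ?_
    rw [compression_pow hI hE, map_smul, smul_apply, smul_smul, smul_smul]
    change _ • I ((modularCayley I E ^ (2 * k + 1)) (E x)) = _
    congr 1
    have h3 : ((-1 : ℝ) ^ k) * (-1) ^ k = 1 := by rw [← mul_pow]; simp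
    linear_combination (-2 / (2 * k + 1)) * h3
  have h₂ : ∀ n, E ((-2 : ℝ) • oddPartialSum (fun k => ((-1) ^ k / (2 * k + 1) : ℝ))
      (E * I * E) n x) =
      (-2 : ℝ) • oddPartialSum (fun k => ((-1) ^ k / (2 * k + 1) : ℝ)) (E * I * E) n x := by
    intro n
    rw [map_smul, oddPartialSum_apply, map_sum]
    congr 1
    refine Finset.sum_congr rfl fun k _ => ?_
    rw [map_smul, pow_succ']
    congr 1
    exact starProjection_idem_of_eq hE _
  have h₃ : ∀ w, Tendsto (fun n => (-2 : ℝ) •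
      oddPartialSum (fun k => ((-1) ^ k / (2 * k + 1) : ℝ)) (E * I * E) n x) atTop (𝓝 w) →
      E w = w := fun w hw =>
    tendsto_nhds_unique (((E.continuous.tendsto w).comp hw).congr h₂) hw
  constructor
  · rintro ⟨y, hy, rfl⟩
    have h₄ := ((I.continuous.tendsto y).comp hy).congr fun n => (h₁ n).symm
    rwa [h₃ _ h₄]
  · intro hz
    refine ⟨-I z, ?_, ?_⟩
    · refine (((I.continuous.tendsto z).comp hz).neg).congr fun n => ?_
      simp only [Function.comp]
      rw [h₁, hI.apply_apply, neg_neg]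
    · rw [map_neg, hI.apply_apply, neg_neg, h₃ z hz]

end Modular

/-! ### Complexification of the power series -/

namespace Complexification

theorem tendsto_iff {H : Type*} [NormedAddCommGroup H]
    {x : ℕ → Complexification H} {y : Complexification H} :
    Tendsto x atTop (𝓝 y) ↔
      Tendsto (fun n => (x n).re) atTop (𝓝 y.re) ∧ Tendsto (fun n => (x n).im) atTop (𝓝 y.im) := by
  constructor
  · intro h
    have h₁ := ((WithLp.prod_continuous_ofLp 2 H H).tendsto y).comp h
    exact ⟨(continuous_fst.tendsto _).comp h₁, (continuous_snd.tendsto _).comp h₁⟩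
  · rintro ⟨h₁, h₂⟩
    exact ((WithLp.prod_continuous_toLp 2 H H).tendsto (y.re, y.im)).comp (h₁.prodMk_nhds h₂)

variable {H : Type*} [NormedAddCommGroup H] [InnerProductSpace ℝ H]

theorem re_ofReal_smul (c : ℝ) (x : Complexification H) : ((c : ℂ) • x).re = c • x.re := by
  simp only [re_smul, Complex.ofReal_re, Complex.ofReal_im, zero_smul, sub_zero]

theorem im_ofReal_smul (c : ℝ) (x : Complexification H) : ((c : ℂ) • x).im = c • x.im := by
  simp only [im_smul, Complex.ofReal_re, Complex.ofReal_im, zero_smul, add_zero]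

theorem mapCLM_neg (A : H →L[ℝ] H) : mapCLM (-A) = -mapCLM A := by
  ext x <;> rfl

theorem mapCLM_pow_apply (A : H →L[ℝ] H) (n : ℕ) (x : Complexification H) :
    (mapCLM A ^ n) x = mk ((A ^ n) x.re) ((A ^ n) x.im) := by
  induction n with
  | zero => rfl
  | succ n ih =>
    rw [pow_succ', pow_succ', mul_apply_eq_comp, ih]
    rfl

theorem oddPartialSum_mapCLM (c : ℕ → ℝ) (A : H →L[ℝ] H) (n : ℕ) (x : Complexification H) :
    oddPartialSum (fun k => (c k : ℂ)) (mapCLM A) n x =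
      mk (oddPartialSum c A n x.re) (oddPartialSum c A n x.im) := by
  simp only [oddPartialSum_apply]
  induction n with
  | zero => rfl
  | succ n ih =>
    rw [Finset.sum_range_succ, Finset.sum_range_succ, Finset.sum_range_succ, ih, mapCLM_pow_apply]
    ext
    · rw [re_add, re_ofReal_smul]
      rfl
    · rw [im_add, im_ofReal_smul]
      rfl

theorem norm_mapCLM_lt {A : H →L[ℝ] H} (hA : ∀ x, x ≠ 0 → ‖A x‖ < ‖x‖) {x : Complexification H}
    (hx : x ≠ 0) : ‖mapCLM A x‖ < ‖x‖ := by
  have hle : ∀ v, ‖A v‖ ^ 2 ≤ ‖v‖ ^ 2 := fun v => by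
    by_cases hv : v = 0
    · simp [hv]
    · exact pow_le_pow_left₀ (norm_nonneg _) (hA v hv).le 2
  have hlt : ∀ v, v ≠ 0 → ‖A v‖ ^ 2 < ‖v‖ ^ 2 := fun v hv =>
    pow_lt_pow_left₀ (hA v hv) (norm_nonneg _) two_ne_zero
  refine lt_of_pow_lt_pow_left₀ 2 (norm_nonneg _) ?_
  rw [norm_sq, norm_sq, re_mapCLM, im_mapCLM]
  by_cases h : x.re = 0
  · have h' : x.im ≠ 0 := fun h' => hx (Complexification.ext h h')
    linarith [hle x.re, hlt x.im h']
  · linarith [hlt x.re h, hle x.im]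

end Complexification

/-! ### The compressed modular generator as an arctangent -/

theorem mem_smulGraph_iff {𝕜 K : Type*} [RCLike 𝕜] [NormedAddCommGroup K] [InnerProductSpace 𝕜 K]
    {c : 𝕜} (hc : c ≠ 0) {A : Set (K × K)} {x y : K} :
    (x, y) ∈ smulGraph c A ↔ (x, c⁻¹ • y) ∈ A := by
  constructor
  · rintro ⟨z, hz, h⟩
    have h' : y = c • z := h
    rwa [h', inv_smul_smul₀ hc]
  · exact fun h => ⟨_, h, (smul_inv_smul₀ hc y).symm⟩

end

open Complexification in
theorem lemma1 {H : Type*} [NormedAddCommGroup H] [InnerProductSpace ℝ H] [CompleteSpace H]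
    (I : H →L[ℝ] H) (hI : IsComplexStructure I)
    (L : ClosedSubmodule ℝ H) (hL : IsStandard I L)
    (E : H →L[ℝ] H) (hE : E = L.toSubmodule.starProjection) :
    complexifyGraph (restrictedModularGenerator I L) =
        smulGraph (-2 : ℂ)
          (borelCalculus Complex.arctan (graphOfCLM (Complexification.mapCLM (E ∘L I ∘L E)))) ∧
      ∀ G : Complexification H →L[ℂ] Complexification H,
        Complexification.mapCLM I =
            -Complex.I • (ContinuousLinearMap.id ℂ (Complexification H) - (2 : ℂ) • G) →
          complexifyGraph (restrictedModularGenerator I L) =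
            smulGraph (-Complex.I) (modularHamiltonian (Complexification.mapCLM E) G) := by
  have hadj : ContinuousLinearMap.adjoint (mapCLM (E * I * E)) = -mapCLM (E * I * E) := by
    rw [adjoint_mapCLM, adjoint_compression hI hE, mapCLM_neg]
  have hlt : ∀ x : Complexification H, x ≠ 0 → ‖mapCLM (E * I * E) x‖ < ‖x‖ := fun x =>
    norm_mapCLM_lt fun x => norm_compression_lt hI hL hE
  -- the complexified left-hand side is the limit of the partial sums of `-2 arctan (E I E)`
  have hleft : ∀ x y : Complexification H,
      (x, y) ∈ complexifyGraph (restrictedModularGenerator I L) ↔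
        Tendsto (fun n => (-2 : ℂ) • oddPartialSum (fun k => ((-1) ^ k / (2 * k + 1) : ℂ))
          (mapCLM (E * I * E)) n x) atTop (𝓝 y) := fun x y => by
    change (x.re, y.re) ∈ restrictedModularGenerator I L ∧
      (x.im, y.im) ∈ restrictedModularGenerator I L ↔ _
    rw [mem_restrictedModularGenerator_iff hI hL hE, mem_restrictedModularGenerator_iff hI hL hE,
      Complexification.tendsto_iff]
    have h := fun n => oddPartialSum_mapCLM (fun k => ((-1) ^ k / (2 * k + 1) : ℝ)) (E * I * E) n x
    push_cast at h
    have h2 : (-2 : ℂ) = ((-2 : ℝ) : ℂ) := by norm_num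
    simp only [h, h2, re_ofReal_smul, im_ofReal_smul, re_mk, im_mk]
  have hscale : ∀ (c : ℂ), c ≠ 0 → ∀ (u : ℕ → Complexification H) y,
      Tendsto u atTop (𝓝 (c⁻¹ • y)) ↔ Tendsto (fun n => c • u n) atTop (𝓝 y) := fun c hc u y => by
    constructor
    · intro h
      simpa [smul_inv_smul₀ hc] using h.const_smul c
    · intro h
      simpa [inv_smul_smul₀ hc] using h.const_smul c⁻¹
  refine ⟨?_, fun G hG => ?_⟩
  · ext ⟨x, y⟩
    have h2 : (-2 : ℂ) ≠ 0 := by norm_num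
    have hcomp : E ∘L I ∘L E = E * I * E := rfl
    rw [hleft, mem_smulGraph_iff h2, hcomp, mem_borelCalculus_arctan_iff hadj hlt, hscale _ h2]
  · have hEE : ∀ x, mapCLM E (mapCLM E x) = mapCLM E x := fun x => by
      ext <;> simp [starProjection_idem_of_eq hE]
    have hop : Complex.I • (mapCLM E - (2 : ℂ) • (mapCLM E ∘L G ∘L mapCLM E)) =
        -mapCLM (E * I * E) := by
      apply ContinuousLinearMap.ext
      intro x
      have h₁ : mapCLM I (mapCLM E x) =
          -Complex.I • (mapCLM E x - (2 : ℂ) • G (mapCLM E x)) :=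
        congrArg (fun A : Complexification H →L[ℂ] Complexification H => A (mapCLM E x)) hG
      have h₂ : mapCLM (E * I * E) x = mapCLM E (mapCLM I (mapCLM E x)) := rfl
      rw [neg_apply, h₂, h₁, map_smul, map_sub, map_smul, hEE, neg_smul, neg_neg]
      rfl
    have hadj' : ContinuousLinearMap.adjoint (-mapCLM (E * I * E)) = - -mapCLM (E * I * E) := by
      rw [map_neg, hadj]
    have hlt' : ∀ x : Complexification H, x ≠ 0 → ‖(-mapCLM (E * I * E)) x‖ < ‖x‖ := fun x hx => by
      rw [neg_apply, norm_neg]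
      exact hlt x hx
    -- `i (1_V - 2 G_V)` is `-E I E`, and the partial sums are odd
    have hodd : ∀ c n x, oddPartialSum c (-mapCLM (E * I * E)) n x =
        -oddPartialSum c (mapCLM (E * I * E)) n x := fun c n x => by
      rw [oddPartialSum_apply, oddPartialSum_apply, ← Finset.sum_neg_distrib]
      refine Finset.sum_congr rfl fun k _ => ?_
      rw [Odd.neg_pow ⟨k, rfl⟩, neg_apply, smul_neg]
    ext ⟨x, y⟩
    have h2 : (2 * Complex.I : ℂ) ≠ 0 := by simp
    have h3 : (-Complex.I : ℂ) ≠ 0 := by simp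
    rw [hleft, modularHamiltonian, hop, mem_smulGraph_iff h3, mem_smulGraph_iff h2,
      mem_borelCalculus_arctan_iff hadj' hlt', hscale _ h2, hscale _ h3]
    have hcoef : -Complex.I * (2 * Complex.I) = 2 := by
      linear_combination (-2) * Complex.I_mul_I
    simp only [hodd, smul_smul, hcoef, smul_neg, neg_smul]
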